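/- Let $\mathbb K=\mathbb R$ or $\mathbb C$, let $X_1,\dots,X_8$ be the standard basis of $\mathbb K^8$ and $\alpha_1,\dots,\alpha_8$ the dual basis. Let $2Nilp_8(\mathbb K)$ be the affine variety of Lie brackets $\mu$ on $\mathbb K^8$ with $\mu(\mu(x,y),z)=0$ for all $x,y,z$ (given by their structure constants, the zero bracket included), with its Zariski topology and the action $(g\cdot\mu)(x,y)=g\,\mu(g^{-1}x,g^{-1}y)$ of $GL_8(\mathbb K)$; the orbit $\mathcal O(\mu)$ is the set of brackets isomorphic to $\mu$, and $\overline{S}$ denotes the Zariski closure of $S$ in $2Nilp_8(\mathbb K)$. The characteristic sequence of a nilpotent Lie algebra $\mathfrak g\neq 0$ is the lexicographic maximum, over $X\in\mathfrak g\setminus[\mathfrak g,\mathfrak g]$, of the decreasing sequence of sizes of the Jordan blocks of $\mathrm{ad}\,X$. Let $\mathcal F^{8,2}_{2,4}\subset 2Nilp_8(\mathbb K)$ be the set of brackets with characteristic sequence $(2,2,1,1,1,1)$. Let $\mathcal C_1(\mathcal F^{8,2}_{2,4})$ be the set of all brackets on $\mathbb K^8$ that are isomorphic to a bracket of the form $\mu_0+\varphi$,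 where $\mu_0$ is the skew-symmetric bracket whose only nonzero products of basis vectors are $[X_1,X_2]=X_3$, $[X_1,X_4]=X_5$ (and those deduced by skew-symmetry), and $\varphi$ is skew-symmetric with $\varphi(X_i,X_j)=a_{ij}^3X_3+a_{ij}^5X_5$ for $i,j\in\{2,4,6,7,8\}$ (arbitrary $a_{ij}^k\in\mathbb K$) and $\varphi(X_i,\cdot)=0$ for $i\in\{1,3,5\}$. Finally let $\mathfrak k_8$ be the Lie algebra on $\mathbb K^8$ with Maurer-Cartan equations (where $d\alpha(x,y)=-\alpha([x,y])$) $$d\alpha_3=\alpha_1\wedge\alpha_2+\alpha_4\wedge\alpha_6+\alpha_7\wedge\alpha_8,\qquad d\alpha_5=\alpha_1\wedge\alpha_4+\alpha_2\wedge\alpha_8+\alpha_6\wedge\alpha_7,\qquad d\alpha_i=0\ (i\ne 3,5).$$ 1. For $\mathbb K=\mathbb R$ and for $\mathbb K=\mathbb C$, the component $\mathcal C_1(\mathcal F^{8,2}_{2,4})$ is the Zariski closure of the orbit of $\mathfrak k_8$: within the family one has $\mathcal C_1(\mathcal F^{8,2}_{2,4})=\mathcal F^{8,2}_{2,4}\cap\overline{\mathcal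 O(\mathfrak k_8)}$, and in $2Nilp_8(\mathbb K)$ one has $\overline{\mathcal C_1(\mathcal F^{8,2}_{2,4})}=\overline{\mathcal O(\mathfrak k_8)}$. 2. For $\mathbb K=\mathbb C$, every Lie algebra of $\overline{\mathcal C_1(\mathcal F^{8,2}_{2,4})}$ (in particular every Lie algebra of $\mathcal C_1(\mathcal F^{8,2}_{2,4})$) that is not isomorphic to $\mathfrak k_8$ is a contraction of $\mathfrak k_8$: for its bracket $\mu$ there is a continuous map $f:\,]0,1]\to GL_8(\mathbb C)$ such that $\lim_{\varepsilon\to0^+}f(\varepsilon)\bigl([f(\varepsilon)^{-1}x,f(\varepsilon)^{-1}y]_{\mathfrak k_8}\bigr)=\mu(x,y)$ for all $x,y\in\mathbb C^8$. -/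

import Mathlib

open Filter Topology

noncomputable section

namespace TwoNilp

/-- Bilinear multiplications on `𝕜ⁿ`; `Pi.single i 1` is the basis vector `X_{i+1}`. -/
abbrev Bracket (𝕜 : Type*) [Field 𝕜] (n : ℕ) :=
  (Fin n → 𝕜) →ₗ[𝕜] (Fin n → 𝕜) →ₗ[𝕜] (Fin n → 𝕜)

section General

variable {𝕜 : Type*} [Field 𝕜] {n : ℕ}

/-- `μ` is a Lie bracket on `𝕜ⁿ`: alternating, with the Jacobi identity. -/
def IsLieBracket (μ : Bracket 𝕜 n) : Prop :=
  (∀ x, μ x x = 0) ∧ ∀ x y z, μ (μ x y) z + μ (μ y z) x + μ (μ z x) y = 0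

variable (𝕜 n) in
/-- The variety `2Nilp_n` of Lie brackets on `𝕜ⁿ` with `[[x, y], z] = 0`. As a (closed) variety
it contains the abelian bracket. -/
def twoNilp : Set (Bracket 𝕜 n) :=
  {μ | IsLieBracket μ ∧ ∀ x y z, μ (μ x y) z = 0}

/-- The derived algebra `C¹ = [𝕜ⁿ, 𝕜ⁿ]` of a bracket. -/
def derived (μ : Bracket 𝕜 n) : Submodule 𝕜 (Fin n → 𝕜) :=
  Submodule.span 𝕜 {z | ∃ x y, μ x y = z}

/-- `l` is the decreasing list of the sizes of the Jordan blocks of the nilpotent endomorphism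
`T`: there is a basis `b (i, j)`, `j < l[i]`, with `T b (i, 0) = 0` and
`T b (i, j + 1) = b (i, j)`. -/
def IsNilpotentJordanType {V : Type*} [AddCommGroup V] [Module 𝕜 V] (T : V →ₗ[𝕜] V)
    (l : List ℕ) : Prop :=
  l.Pairwise (· ≥ ·) ∧ (∀ k ∈ l, 0 < k) ∧
    ∃ b : Module.Basis (Σ i : Fin l.length, Fin (l.get i)) 𝕜 V,
      ∀ (i : Fin l.length) (j : Fin (l.get i)),
        (j.val = 0 → T (b ⟨i, j⟩) = 0) ∧
        ∀ j' : Fin (l.get i), j'.val = j.val + 1 → T (b ⟨i, j'⟩) = b ⟨i, j⟩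

/-- `l` is the characteristic sequence of `μ`: the maximum, for the lexicographic order, of the
Jordan types of `ad X`, where `X` runs through the complement of the derived algebra. -/
def HasCharacteristicSequence (μ : Bracket 𝕜 n) (l : List ℕ) : Prop :=
  (∃ X, X ∉ derived μ ∧ IsNilpotentJordanType (μ X) l) ∧
    ∀ X, X ∉ derived μ → ∀ l', IsNilpotentJordanType (μ X) l' → l' ≤ l

/-- The action of `GL_n` on brackets: `(g • μ) (x, y) = g (μ (g⁻¹ x, g⁻¹ y))`. -/
def transport (g : GL (Fin n) 𝕜) (μ : Bracket 𝕜 n) : Bracket 𝕜 n :=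
  (μ.compl₁₂ (Matrix.toLin' (g⁻¹ : GL (Fin n) 𝕜).val)
    (Matrix.toLin' (g⁻¹ : GL (Fin n) 𝕜).val)).compr₂ (Matrix.toLin' g.val)

/-- The orbit of `μ`, that is, the set of all brackets isomorphic to `μ`. -/
def orbit (μ : Bracket 𝕜 n) : Set (Bracket 𝕜 n) :=
  {ν | ∃ g : GL (Fin n) 𝕜, ν = transport g μ}

/-- The structure constants of `μ`: `μ (X_i, X_j) = ∑ₖ C (i, j, k) X_k`. -/
def structureConstants (μ : Bracket 𝕜 n) : Fin n × Fin n × Fin n → 𝕜 :=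
  fun t => μ (Pi.single t.1 1) (Pi.single t.2.1 1) t.2.2

/-- The closure of `S` in `2Nilp_n` for the Zariski topology: the elements of `2Nilp_n` whose
structure constants are zeros of all polynomials that vanish on `S`. -/
def zariskiClosure (S : Set (Bracket 𝕜 n)) : Set (Bracket 𝕜 n) :=
  {μ | μ ∈ twoNilp 𝕜 n ∧
    structureConstants μ ∈
      MvPolynomial.zeroLocus 𝕜 (MvPolynomial.vanishingIdeal 𝕜 (structureConstants '' S))}

/-- The form `α_{i+1} ∧ α_{j+1}`, where the `α`s are the dual basis of the `X`s. -/
def wedge (i j : Fin n) : (Fin n → 𝕜) →ₗ[𝕜] (Fin n → 𝕜) →ₗ[𝕜] 𝕜 :=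
  LinearMap.mk₂ 𝕜 (fun x y => x i * y j - x j * y i)
    (fun x x' y => by simp only [Pi.add_apply]; ring)
    (fun c x y => by simp only [Pi.smul_apply, smul_eq_mul]; ring)
    (fun x y y' => by simp only [Pi.add_apply]; ring)
    (fun c x y => by simp only [Pi.smul_apply, smul_eq_mul]; ring)

/-- The multiplication `(x, y) ↦ ω (x, y) X_{k+1}`. -/
def along (ω : (Fin n → 𝕜) →ₗ[𝕜] (Fin n → 𝕜) →ₗ[𝕜] 𝕜) (k : Fin n) : Bracket 𝕜 n :=
  ω.compr₂ (LinearMap.toSpanSingleton 𝕜 (Fin n → 𝕜) (Pi.single k 1))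

end General

section Dimension8

variable (𝕜 : Type*) [Field 𝕜]

/-- The family `F^{8,2}_{2,4}` of `8`-dimensional `2`-step nilpotent Lie algebras of
characteristic sequence `(2,2,1,1,1,1)`. -/
def F24 : Set (Bracket 𝕜 8) :=
  {μ | μ ∈ twoNilp 𝕜 8 ∧ HasCharacteristicSequence μ [2, 2, 1, 1, 1, 1]}

/-- The Lie algebra `g_{2,4}`: `[X₁, X₂] = X₃`, `[X₁, X₄] = X₅`. -/
def g24 : Bracket 𝕜 8 := along (wedge 0 1) 2 + along (wedge 0 3) 4

/-- The cocycles that give the first component: skew-symmetric `φ` with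
`φ (X_i, X_j) = a_{ij}³ X₃ + a_{ij}⁵ X₅` for `i, j ∈ {2, 4, 6, 7, 8}` and `φ (X_i, ·) = 0` for
`i ∈ {1, 3, 5}`. -/
def cocyclesC1 : Set (Bracket 𝕜 8) :=
  {φ | (∀ x, φ x x = 0) ∧
    (∀ y, φ (Pi.single 0 1) y = 0 ∧ φ (Pi.single 2 1) y = 0 ∧ φ (Pi.single 4 1) y = 0) ∧
    ∀ x y, φ x y ∈ Submodule.span 𝕜 {(Pi.single 2 1 : Fin 8 → 𝕜), Pi.single 4 1}}

/-- The first component `C₁(F^{8,2}_{2,4})`: all brackets isomorphic to some `g_{2,4} + φ`, with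
`φ` as above. -/
def C1 : Set (Bracket 𝕜 8) :=
  {μ | ∃ φ ∈ cocyclesC1 𝕜, μ ∈ orbit (g24 𝕜 + φ)}

/-- The Lie algebra `k₈`. With `dα (x, y) = -α [x, y]`, its Maurer-Cartan equations are
`dα₃ = α₁∧α₂ + α₄∧α₆ + α₇∧α₈`, `dα₅ = α₁∧α₄ + α₂∧α₈ + α₆∧α₇`, and `dα_i = 0` otherwise. -/
def k8 : Bracket 𝕜 8 :=
  -along (wedge 0 1 + wedge 3 5 + wedge 6 7) 2 - along (wedge 0 3 + wedge 1 7 + wedge 5 6) 4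

end Dimension8

/-- `μ₀` is a contraction of `μ`: there is a continuous `f : ]0, 1] → GL_n` such that
`f(ε) [f(ε)⁻¹ x, f(ε)⁻¹ y] → μ₀ (x, y)` as `ε → 0`, for all `x, y`. -/
def IsContraction {𝕜 : Type*} [RCLike 𝕜] {n : ℕ} (μ₀ μ : Bracket 𝕜 n) : Prop :=
  ∃ f : ℝ → GL (Fin n) 𝕜, ContinuousOn f (Set.Ioc 0 1) ∧
    ∀ x y, Tendsto (fun ε => transport (f ε) μ x y) (𝓝[>] 0) (𝓝 (μ₀ x y))

end TwoNilp

end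

noncomputable section

namespace TwoNilp

/-! ### Change of basis, the orbit relation and the derived algebra. -/

section Basic

variable {𝕜 : Type*} [Field 𝕜] {n : ℕ}

/-! Everything follows from one description: over ℝ and over ℂ, the closure of the orbit of `k8` is
the set of two-step nilpotent brackets whose derived algebra has dimension at most 2
(`mem_zariskiClosure_orbit_k8`). The component C₁ is cut out of the family by the same dimension
condition (`mem_C1_iff_F24`), so both equalities of part 1 result.

The dimension bound passes to the closure because it is given by vanishing determinants. The
converse is first proved over ℂ, in the stronger form of a contraction (`isContraction_k8`). Such a
μ takes its values in a central plane Z (`exists_central_plane`), hence amounts to a pencil of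
alternating forms on a space of dimension 6. Over an algebraically closed field some combination of
the two forms is always singular; used three times, this gives a flag and a basis in which μ is
anti-triangular (`exists_antitriangular_frame`).

Add to μ a small multiple s of the antidiagonal model `diagonalBracket`. For small s > 0 the three
antidiagonal entries become pairwise independent in Z, and transvections then remove all other
entries (`exists_antidiagonal`): the perturbed bracket is isomorphic to the model, hence to `k8` by
a cube root of unity. The elimination needs only a commutative ring in which certain determinants
are units. Run over the ring of continuous functions on ]0, 1], it yields a continuous path of base
changes at once, and s → 0 gives the contraction.

For the Zariski statement, a polynomial vanishing on the orbit over 𝕜 pulls back to the zero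
polynomial in the matrix entries, so it vanishes on the complex orbit (`eval₂_orbit_eq_zero`) and,
by continuity, on its contractions. -/

theorem transport_apply (g : GL (Fin n) 𝕜) (μ : Bracket 𝕜 n) (x y : Fin n → 𝕜) :
    transport g μ x y = g.val.mulVec (μ ((g⁻¹).val.mulVec x) ((g⁻¹).val.mulVec y)) := by
  simp [transport, LinearMap.compl₁₂_apply]

theorem GL_inv_mulVec (g : GL (Fin n) 𝕜) (x : Fin n → 𝕜) :
    (g⁻¹).val.mulVec (g.val.mulVec x) = x := by
  rw [Matrix.mulVec_mulVec, ← Units.val_mul, inv_mul_cancel, Units.val_one, Matrix.one_mulVec]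

theorem GL_mulVec_inv (g : GL (Fin n) 𝕜) (x : Fin n → 𝕜) :
    g.val.mulVec ((g⁻¹).val.mulVec x) = x := by
  rw [Matrix.mulVec_mulVec, ← Units.val_mul, mul_inv_cancel, Units.val_one, Matrix.one_mulVec]

theorem transport_mulVec (g : GL (Fin n) 𝕜) (μ : Bracket 𝕜 n) (x y : Fin n → 𝕜) :
    transport g μ (g.val.mulVec x) (g.val.mulVec y) = g.val.mulVec (μ x y) := by
  rw [transport_apply, GL_inv_mulVec, GL_inv_mulVec]

theorem transport_mul (g h : GL (Fin n) 𝕜) (μ : Bracket 𝕜 n) :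
    transport (g * h) μ = transport g (transport h μ) := by
  refine LinearMap.ext₂ fun x y => ?_
  simp only [transport_apply, mul_inv_rev, Units.val_mul, Matrix.mulVec_mulVec]

theorem transport_one (μ : Bracket 𝕜 n) : transport 1 μ = μ := by
  refine LinearMap.ext₂ fun x y => ?_
  simp [transport_apply]

theorem eq_transport_iff {g : GL (Fin n) 𝕜} {μ ν : Bracket 𝕜 n} :
    ν = transport g μ ↔ ∀ x y, ν (g.val.mulVec x) (g.val.mulVec y) = g.val.mulVec (μ x y) := by
  constructor
  · rintro rfl x y
    exact transport_mulVec g μ x y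
  · intro h
    refine LinearMap.ext₂ fun x y => ?_
    rw [transport_apply, ← h, GL_mulVec_inv, GL_mulVec_inv]

theorem bracket_ext {μ ν : Bracket 𝕜 n}
    (h : ∀ i j, μ (Pi.single i 1) (Pi.single j 1) = ν (Pi.single i 1) (Pi.single j 1)) : μ = ν :=
  LinearMap.ext_basis (Pi.basisFun 𝕜 (Fin n)) (Pi.basisFun 𝕜 (Fin n)) fun i j => by
    simpa using h i j

/-- A bracket is transported by `g` as soon as this holds on the basis vectors. -/
theorem eq_transport_of_basis {g : GL (Fin n) 𝕜} {μ ν : Bracket 𝕜 n}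
    (h : ∀ i j, ν (g.val.mulVec (Pi.single i 1)) (g.val.mulVec (Pi.single j 1)) =
      g.val.mulVec (μ (Pi.single i 1) (Pi.single j 1))) : ν = transport g μ := by
  rw [eq_transport_iff]
  have : ν.compl₁₂ (Matrix.toLin' g.val) (Matrix.toLin' g.val) = μ.compr₂ (Matrix.toLin' g.val) :=
    bracket_ext fun i j => by simpa [LinearMap.compl₁₂_apply] using h i j
  intro x y
  simpa [LinearMap.compl₁₂_apply] using LinearMap.congr_fun₂ this x y

theorem mem_orbit_symm {μ ν : Bracket 𝕜 n} (h : μ ∈ orbit ν) : ν ∈ orbit μ := by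
  obtain ⟨g, rfl⟩ := h
  exact ⟨g⁻¹, by rw [← transport_mul, inv_mul_cancel, transport_one]⟩

theorem mem_orbit_trans {μ ν κ : Bracket 𝕜 n} (h : μ ∈ orbit ν) (h' : ν ∈ orbit κ) :
    μ ∈ orbit κ := by
  obtain ⟨g, rfl⟩ := h
  obtain ⟨g', rfl⟩ := h'
  exact ⟨g * g', by rw [transport_mul]⟩

theorem alt_neg {R V Z : Type*} [CommRing R] [AddCommGroup V] [AddCommGroup Z] [Module R V]
    [Module R Z] {μ : V →ₗ[R] V →ₗ[R] Z} (h : ∀ x, μ x x = 0) (x y : V) :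
    μ y x = - μ x y := by
  have := h (x + y)
  simp only [map_add, LinearMap.add_apply, h, zero_add, add_zero] at this
  exact eq_neg_of_add_eq_zero_left this

/-- `2Nilp` is cut out by alternation and two-step nilpotency: the Jacobi identity follows. -/
theorem mem_twoNilp {μ : Bracket 𝕜 n} :
    μ ∈ twoNilp 𝕜 n ↔ (∀ x, μ x x = 0) ∧ ∀ x y z, μ (μ x y) z = 0 :=
  ⟨fun h => ⟨h.1.1, h.2⟩, fun h => ⟨⟨h.1, by simp [h.2]⟩, h.2⟩⟩

theorem transport_mem_twoNilp (g : GL (Fin n) 𝕜) {μ : Bracket 𝕜 n} (h : μ ∈ twoNilp 𝕜 n) :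
    transport g μ ∈ twoNilp 𝕜 n := by
  rw [mem_twoNilp] at *
  refine ⟨fun x => by simp [transport_apply, h.1], fun x y z => ?_⟩
  simp only [transport_apply, GL_inv_mulVec, h.2, Matrix.mulVec_zero]

theorem mem_derived (μ : Bracket 𝕜 n) (x y : Fin n → 𝕜) : μ x y ∈ derived μ :=
  Submodule.subset_span ⟨x, y, rfl⟩

theorem derived_le {μ : Bracket 𝕜 n} {p : Submodule 𝕜 (Fin n → 𝕜)} (h : ∀ x y, μ x y ∈ p) :
    derived μ ≤ p :=
  Submodule.span_le.2 (by rintro _ ⟨x, y, rfl⟩; exact h x y)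

theorem derived_transport_le (g : GL (Fin n) 𝕜) (μ : Bracket 𝕜 n) :
    derived (transport g μ) ≤ (derived μ).map (Matrix.toLin' g.val) :=
  derived_le fun x y => by
    rw [transport_apply, ← Matrix.toLin'_apply]
    exact Submodule.mem_map_of_mem (mem_derived μ _ _)

theorem finrank_derived_transport_le (g : GL (Fin n) 𝕜) (μ : Bracket 𝕜 n) :
    Module.finrank 𝕜 (derived (transport g μ)) ≤ Module.finrank 𝕜 (derived μ) :=
  (Submodule.finrank_mono (derived_transport_le g μ)).trans (Submodule.finrank_map_le _ _)

theorem derived_central {μ : Bracket 𝕜 n} (h : μ ∈ twoNilp 𝕜 n) {z : Fin n → 𝕜}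
    (hz : z ∈ derived μ) (y : Fin n → 𝕜) : μ z y = 0 := by
  have : derived μ ≤ LinearMap.ker (μ.flip y) := derived_le fun a b => by
    simpa using h.2 a b y
  simpa using this hz

theorem derived_central' {μ : Bracket 𝕜 n} (h : μ ∈ twoNilp 𝕜 n) {z : Fin n → 𝕜}
    (hz : z ∈ derived μ) (y : Fin n → 𝕜) : μ y z = 0 := by
  rw [alt_neg h.1.1 z y, derived_central h hz, neg_zero]

/-- A linearly independent family of `n` vectors is the family of columns of some `g ∈ GL_n`. -/
theorem exists_GL_of_linearIndependent {b : Fin n → Fin n → 𝕜} (hb : LinearIndependent 𝕜 b) :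
    ∃ g : GL (Fin n) 𝕜, ∀ i, g.val.mulVec (Pi.single i 1) = b i := by
  have hu : IsUnit (Matrix.of b).transpose :=
    Matrix.linearIndependent_cols_iff_isUnit.1 hb
  refine ⟨hu.unit, fun i => ?_⟩
  ext j
  simp

@[simp] theorem wedge_apply (i j : Fin n) (x y : Fin n → 𝕜) :
    wedge i j x y = x i * y j - x j * y i := rfl

@[simp] theorem along_apply (ω : (Fin n → 𝕜) →ₗ[𝕜] (Fin n → 𝕜) →ₗ[𝕜] 𝕜) (k : Fin n)
    (x y : Fin n → 𝕜) : along ω k x y = ω x y • Pi.single k 1 := rfl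

end Basic

/-! ### Bilinear products over a commutative ring from structure constants, and base change. -/

section Constants

variable {R S : Type*} [CommRing R] [CommRing S] {n : ℕ}

/-- The bilinear multiplication on `Rⁿ` with given structure constants. -/
def ofConstants (c : Fin n × Fin n × Fin n → R) :
    (Fin n → R) →ₗ[R] (Fin n → R) →ₗ[R] (Fin n → R) :=
  LinearMap.mk₂ R (fun x y k => ∑ i, ∑ j, x i * y j * c (i, j, k))
    (fun x x' y => by ext k; simp [add_mul, Finset.sum_add_distrib])
    (fun a x y => by ext k; simp [Finset.mul_sum, mul_assoc])
    (fun x y y' => by ext k; simp [mul_add, add_mul, Finset.sum_add_distrib])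
    (fun a x y => by ext k; simp [Finset.mul_sum, mul_assoc, mul_left_comm])

theorem ofConstants_apply (c : Fin n × Fin n × Fin n → R) (x y : Fin n → R) (k : Fin n) :
    ofConstants c x y k = ∑ i, ∑ j, x i * y j * c (i, j, k) := rfl

theorem ofConstants_single (c : Fin n × Fin n × Fin n → R) (i j : Fin n) :
    ofConstants c (Pi.single i 1) (Pi.single j 1) = fun k => c (i, j, k) := by
  ext k
  simp [ofConstants_apply, Pi.single_apply]

theorem map_ofConstants (φ : R →+* S) (c : Fin n × Fin n × Fin n → R) (x y : Fin n → R) :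
    φ ∘ (ofConstants c x y) = ofConstants (φ ∘ c) (φ ∘ x) (φ ∘ y) := by
  ext k
  simp [ofConstants_apply, map_sum]

theorem ofConstants_structureConstants {𝕜 : Type*} [Field 𝕜] (μ : Bracket 𝕜 n) :
    ofConstants (structureConstants μ) = μ :=
  bracket_ext fun i j => by rw [ofConstants_single]; rfl

theorem structureConstants_ofConstants {𝕜 : Type*} [Field 𝕜] (c : Fin n × Fin n × Fin n → 𝕜) :
    structureConstants (ofConstants c) = c := by
  ext ⟨i, j, k⟩
  simp [structureConstants, ofConstants_single]

end Constants

/-! ### Elimination by transvections. -/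

section Elimination

variable {A V Z : Type*} [CommRing A] [AddCommGroup V] [AddCommGroup Z] [Module A V] [Module A Z]

/-- An anti-triangular alternating form on six vectors, with values in a module spanned by any two
of the antidiagonal entries, can be made antidiagonal by transvections. -/
theorem exists_antidiagonal (B : V →ₗ[A] V →ₗ[A] Z) (hB : ∀ x, B x x = 0)
    {p₁ p₂ p₃ : Z} (h₁₂ : ∀ v, ∃ x y : A, v = x • p₁ + y • p₂)
    (h₁₃ : ∀ v, ∃ x y : A, v = x • p₁ + y • p₃) (h₂₃ : ∀ v, ∃ x y : A, v = x • p₂ + y • p₃)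
    (e₁ e₂ e₃ f₁ f₂ f₃ : V) (h11 : B e₁ f₁ = p₁) (h22 : B e₂ f₂ = p₂) (h33 : B e₃ f₃ = p₃)
    (he12 : B e₁ e₂ = 0) (he13 : B e₁ e₃ = 0) (he23 : B e₂ e₃ = 0)
    (h12 : B e₁ f₂ = 0) (h13 : B e₁ f₃ = 0) (h23 : B e₂ f₃ = 0) :
    ∃ e₁ e₂ e₃ f₁ f₂ f₃ : V, B e₁ f₁ = p₁ ∧ B e₂ f₂ = p₂ ∧ B e₃ f₃ = p₃ ∧
      B e₁ e₂ = 0 ∧ B e₁ e₃ = 0 ∧ B e₂ e₃ = 0 ∧ B f₁ f₂ = 0 ∧ B f₁ f₃ = 0 ∧ B f₂ f₃ = 0 ∧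
      B e₁ f₂ = 0 ∧ B e₁ f₃ = 0 ∧ B e₂ f₃ = 0 ∧ B e₂ f₁ = 0 ∧ B e₃ f₁ = 0 ∧ B e₃ f₂ = 0 := by
  -- Each of the six passes writes one unwanted entry as x p_i + y p_j and cancels the two terms by
  -- altering its two arguments. The order (e₂,f₁), (e₃,f₂), (e₃,f₁), (f₂,f₃), (f₁,f₃), (f₁,f₂)
  -- ensures that no pass disturbs the antidiagonal or an entry already cleared.
  obtain ⟨e₂, f₁, h11, h22, he12, he23, h23, h21⟩ : ∃ e₂ f₁, B e₁ f₁ = p₁ ∧ B e₂ f₂ = p₂ ∧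
      B e₁ e₂ = 0 ∧ B e₂ e₃ = 0 ∧ B e₂ f₃ = 0 ∧ B e₂ f₁ = 0 := by
    obtain ⟨x, y, h⟩ := h₁₂ (B e₂ f₁)
    refine ⟨e₂ - x • e₁, f₁ - y • f₂, ?_, ?_, ?_, ?_, ?_, ?_⟩ <;> simp [*]
  obtain ⟨e₃, f₂, h22, h33, he13, he23, h12, h32⟩ : ∃ e₃ f₂, B e₂ f₂ = p₂ ∧ B e₃ f₃ = p₃ ∧
      B e₁ e₃ = 0 ∧ B e₂ e₃ = 0 ∧ B e₁ f₂ = 0 ∧ B e₃ f₂ = 0 := by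
    obtain ⟨x, y, h⟩ := h₂₃ (B e₃ f₂)
    refine ⟨e₃ - x • e₂, f₂ - y • f₃, ?_, ?_, ?_, ?_, ?_, ?_⟩ <;> simp [*]
  obtain ⟨e₃, f₁, h11, h21, h33, he13, he23, h32, h31⟩ : ∃ e₃ f₁, B e₁ f₁ = p₁ ∧ B e₂ f₁ = 0 ∧
      B e₃ f₃ = p₃ ∧ B e₁ e₃ = 0 ∧ B e₂ e₃ = 0 ∧ B e₃ f₂ = 0 ∧ B e₃ f₁ = 0 := by
    obtain ⟨x, y, h⟩ := h₁₃ (B e₃ f₁)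
    refine ⟨e₃ - x • e₁, f₁ - y • f₃, ?_, ?_, ?_, ?_, ?_, ?_, ?_⟩ <;>
      simp [*, alt_neg hB e₁ e₂]
  obtain ⟨f₂, f₃, h12, h22, h32, h13, h23, h33, hf23⟩ : ∃ f₂ f₃, B e₁ f₂ = 0 ∧ B e₂ f₂ = p₂ ∧
      B e₃ f₂ = 0 ∧ B e₁ f₃ = 0 ∧ B e₂ f₃ = 0 ∧ B e₃ f₃ = p₃ ∧ B f₂ f₃ = 0 := by
    obtain ⟨x, y, h⟩ := h₂₃ (B f₂ f₃)
    refine ⟨f₂ - y • e₃, f₃ + x • e₂, ?_, ?_, ?_, ?_, ?_, ?_, ?_⟩ <;>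
      simp [*, alt_neg hB e₂ f₂, alt_neg hB e₂ e₃]
  obtain ⟨f₁, f₃, h11, h21, h31, h13, h23, h33, hf13, hf23⟩ : ∃ f₁ f₃, B e₁ f₁ = p₁ ∧
      B e₂ f₁ = 0 ∧ B e₃ f₁ = 0 ∧ B e₁ f₃ = 0 ∧ B e₂ f₃ = 0 ∧ B e₃ f₃ = p₃ ∧ B f₁ f₃ = 0 ∧
      B f₂ f₃ = 0 := by
    obtain ⟨x, y, h⟩ := h₁₃ (B f₁ f₃)
    refine ⟨f₁ - y • e₃, f₃ + x • e₁, ?_, ?_, ?_, ?_, ?_, ?_, ?_, ?_⟩ <;>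
      simp [*, alt_neg hB e₁ f₁, alt_neg hB e₁ f₂, alt_neg hB e₁ e₂, alt_neg hB e₁ e₃]
  obtain ⟨f₁, f₂, h11, h21, h31, h12, h22, h32, hf12, hf13, hf23⟩ : ∃ f₁ f₂, B e₁ f₁ = p₁ ∧
      B e₂ f₁ = 0 ∧ B e₃ f₁ = 0 ∧ B e₁ f₂ = 0 ∧ B e₂ f₂ = p₂ ∧ B e₃ f₂ = 0 ∧ B f₁ f₂ = 0 ∧
      B f₁ f₃ = 0 ∧ B f₂ f₃ = 0 := by
    obtain ⟨x, y, h⟩ := h₁₂ (B f₁ f₂)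
    refine ⟨f₁ - y • e₂, f₂ + x • e₁, ?_, ?_, ?_, ?_, ?_, ?_, ?_, ?_, ?_⟩ <;>
      simp [*, alt_neg hB e₁ f₁, alt_neg hB e₁ e₂, alt_neg hB e₁ e₃, alt_neg hB e₂ e₃]
  exact ⟨e₁, e₂, e₃, f₁, f₂, f₃, h11, h22, h33, he12, he13, he23, hf12, hf13, hf23, h12, h13, h23,
    h21, h31, h32⟩

end Elimination

/-! ### The antidiagonal model and frames realizing it. -/

section Frame

/-- The Lie algebra `[X₁, X₆] = X₇`, `[X₂, X₅] = X₈`, `[X₃, X₄] = X₇ + X₈`, which is isomorphic to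
`k₈` over `ℂ`. -/
def diagonalBracket (𝕜 : Type*) [Field 𝕜] : Bracket 𝕜 8 :=
  along (wedge 0 5 + wedge 2 3) 6 + along (wedge 1 4 + wedge 2 3) 7

/-- The family `b` satisfies the bracket relations of `diagonalBracket`. -/
structure IsFrame {A V : Type*} [CommRing A] [AddCommGroup V] [Module A V]
    (ν : V →ₗ[A] V →ₗ[A] V) (b : Fin 8 → V) : Prop where
  alt : ∀ x, ν x x = 0
  h05 : ν (b 0) (b 5) = b 6
  h14 : ν (b 1) (b 4) = b 7
  h23 : ν (b 2) (b 3) = b 6 + b 7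
  h_zero : ∀ i j : Fin 8, i < j → j ≤ 5 → i.val + j.val ≠ 5 → ν (b i) (b j) = 0
  h6 : ∀ y, ν (b 6) y = 0
  h7 : ∀ y, ν (b 7) y = 0

variable {𝕜 : Type*} [Field 𝕜]

/-- Bracketing a linear relation with `b j`, j ≤ 5, leaves only the coefficient of index 5 − j times
a nonzero vector. What remains is a relation between `b 6` and `b 7`. -/
theorem IsFrame.linearIndependent {ν : Bracket 𝕜 8} {b : Fin 8 → Fin 8 → 𝕜} (h : IsFrame ν b)
    (hz : LinearIndependent 𝕜 ![b 6, b 7]) : LinearIndependent 𝕜 b := by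
  rw [LinearIndependent.pair_iff] at hz
  have hb6 : b 6 ≠ 0 := fun h0 => by simpa using hz 1 0 (by simp [h0])
  have hb7 : b 7 ≠ 0 := fun h0 => by simpa using hz 0 1 (by simp [h0])
  have hb67 : b 6 + b 7 ≠ 0 := fun h0 => by simpa using hz 1 1 (by simpa using h0)
  have h50 := alt_neg h.alt (b 0) (b 5)
  have h41 := alt_neg h.alt (b 1) (b 4)
  have h32 := alt_neg h.alt (b 2) (b 3)
  have hs : ∀ i j : Fin 8, i < j → j ≤ 5 → i.val + j.val ≠ 5 → ν (b j) (b i) = 0 :=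
    fun i j h1 h2 h3 => by rw [alt_neg h.alt (b i) (b j), h.h_zero i j h1 h2 h3, neg_zero]
  rw [h.h05] at h50
  rw [h.h14] at h41
  rw [h.h23] at h32
  rw [Fintype.linearIndependent_iff]
  intro g hg
  rw [Fin.sum_univ_eight] at hg
  have key := fun j => congrArg (fun x => ν x (b j)) hg
  simp only [map_add, map_smul, LinearMap.add_apply, LinearMap.smul_apply, h.h6, h.h7, map_zero,
    LinearMap.zero_apply, smul_zero, add_zero] at key
  have g0 : g 0 = 0 := by
    have := key 5
    simpa [h.alt, h.h05, h.h_zero, hb6] using this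
  have g1 : g 1 = 0 := by
    have := key 4
    simpa [h.alt, h.h14, h.h_zero, hb7, hs] using this
  have g2 : g 2 = 0 := by
    have : g 2 • (b 6 + b 7) = 0 := by
      simpa [h.alt, h.h23, h.h_zero, hs] using key 3
    exact (smul_eq_zero.1 this).resolve_right hb67
  have g3 : g 3 = 0 := by
    have : g 3 • -(b 6 + b 7) = 0 := by
      simpa only [h.alt, h32, h.h_zero 0 2 (by decide) (by decide) (by decide),
        h.h_zero 1 2 (by decide) (by decide) (by decide), hs 2 4 (by decide) (by decide) (by decide),
        hs 2 5 (by decide) (by decide) (by decide), smul_zero, zero_add, add_zero] using key 2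
    exact (smul_eq_zero.1 this).resolve_right (neg_ne_zero.2 hb67)
  have g4 : g 4 = 0 := by
    have := key 1
    simpa [h.alt, h41, h.h_zero, hb7, hs] using this
  have g5 : g 5 = 0 := by
    have := key 0
    simpa [h.alt, h50, h.h_zero, hb6, hs] using this
  simp only [g0, g1, g2, g3, g4, g5, zero_smul, zero_add] at hg
  obtain ⟨g6, g7⟩ := hz _ _ hg
  intro i
  fin_cases i <;> assumption

theorem IsFrame.eq_transport {ν : Bracket 𝕜 8} {b : Fin 8 → Fin 8 → 𝕜} (h : IsFrame ν b)
    {g : GL (Fin 8) 𝕜} (hg : ∀ i, g.val.mulVec (Pi.single i 1) = b i) :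
    ν = transport g (diagonalBracket 𝕜) := by
  have h50 := alt_neg h.alt (b 0) (b 5)
  have h41 := alt_neg h.alt (b 1) (b 4)
  have h32 := alt_neg h.alt (b 2) (b 3)
  have hs : ∀ i j : Fin 8, i < j → j ≤ 5 → i.val + j.val ≠ 5 → ν (b j) (b i) = 0 :=
    fun i j h1 h2 h3 => by rw [alt_neg h.alt (b i) (b j), h.h_zero i j h1 h2 h3, neg_zero]
  have h6 : ∀ y, ν y (b 6) = 0 := fun y => by rw [alt_neg h.alt (b 6), h.h6, neg_zero]
  have h7 : ∀ y, ν y (b 7) = 0 := fun y => by rw [alt_neg h.alt (b 7), h.h7, neg_zero]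
  rw [h.h05] at h50
  rw [h.h14] at h41
  rw [h.h23] at h32
  refine eq_transport_of_basis fun i j => ?_
  simp only [diagonalBracket, LinearMap.add_apply, along_apply, Matrix.mulVec_add,
    Matrix.mulVec_smul, hg, wedge_apply]
  fin_cases i <;> fin_cases j <;>
    simp [h.alt, h.h05, h.h14, h.h23, h50, h41, h32, hs, h.h6, h.h7, h6, h7, h.h_zero, add_comm]

end Frame

/-! ### Cramer's rule in the plane. -/

section Span

theorem span_of_isUnit_det {A : Type*} [CommRing A] {p q : A × A}
    (h : IsUnit (p.1 * q.2 - p.2 * q.1)) (v : A × A) : ∃ x y : A, v = x • p + y • q := by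
  obtain ⟨d, hd⟩ := h.exists_left_inv
  refine ⟨d * (v.1 * q.2 - v.2 * q.1), d * (p.1 * v.2 - p.2 * v.1), Prod.ext ?_ ?_⟩
  · simp only [Prod.fst_add, Prod.smul_fst, smul_eq_mul]
    linear_combination (-v.1) * hd
  · simp only [Prod.snd_add, Prod.smul_snd, smul_eq_mul]
    linear_combination (-v.2) * hd

end Span

/-! ### From anti-triangular brackets to contractions of the model. -/

section Path

theorem ofConstants_add_smul {R : Type*} [CommRing R] {n : ℕ} (c d : Fin n × Fin n × Fin n → R)
    (a : R) : ofConstants (c + a • d) = ofConstants c + a • ofConstants d := by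
  refine LinearMap.ext₂ fun x y => ?_
  ext k
  simp only [ofConstants_apply, LinearMap.add_apply, LinearMap.smul_apply, Pi.add_apply,
    Pi.smul_apply, smul_eq_mul, Finset.mul_sum, ← Finset.sum_add_distrib]
  exact Finset.sum_congr rfl fun i _ => Finset.sum_congr rfl fun j _ => by ring

theorem eventually_eval_ofReal_ne_zero {q : Polynomial ℂ} (hq : q ≠ 0) :
    ∀ᶠ t : ℝ in 𝓝[>] 0, q.eval (t : ℂ) ≠ 0 := by
  have hfin : {t : ℝ | q.eval (t : ℂ) = 0}.Finite := by
    refine ((q.rootSet_finite ℂ).preimage Complex.ofReal_injective.injOn).subset fun t ht => ?_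
    simpa [Polynomial.mem_rootSet, hq, Polynomial.aeval_def] using ht
  have : ({t : ℝ | q.eval (t : ℂ) = 0} \ {0})ᶜ ∈ 𝓝 (0 : ℝ) :=
    (hfin.subset Set.sdiff_subset).isClosed.compl_mem_nhds (by simp)
  filter_upwards [mem_nhdsWithin_of_mem_nhds this, self_mem_nhdsWithin] with t ht h0 h
  exact ht ⟨h, ne_of_gt h0⟩

theorem eventually_quadratic_ne_zero {a b c : ℂ} (hc : c ≠ 0) :
    ∀ᶠ t : ℝ in 𝓝[>] 0, a + b * t + c * t ^ 2 ≠ 0 := by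
  have hq : (Polynomial.C a + Polynomial.C b * Polynomial.X +
      Polynomial.C c * Polynomial.X ^ 2) ≠ 0 := fun h => hc <| by
    simpa [Polynomial.coeff_X, Polynomial.coeff_C] using congrArg (Polynomial.coeff · 2) h
  filter_upwards [eventually_eval_ofReal_ne_zero hq] with t ht
  simpa using ht

theorem exists_scale {P : ℝ → Prop} (h : ∀ᶠ t in 𝓝[>] (0 : ℝ), P t) :
    ∃ δ > 0, ∀ t ∈ Set.Ioc (0 : ℝ) 1, P (δ * t) := by
  obtain ⟨u, hu, h⟩ := mem_nhdsGT_iff_exists_Ioc_subset.1 h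
  have hu : (0 : ℝ) < u := hu
  refine ⟨u, hu, fun t ht => h ⟨mul_pos hu ht.1, ?_⟩⟩
  nlinarith [ht.2]

variable {𝕜 : Type*} [RCLike 𝕜] {n : ℕ}

/-- A matrix in `GL_n` over the continuous functions on `]0, 1]` is a continuous path. -/
theorem isContraction_of_family {μ ν : Bracket 𝕜 n} (G : GL (Fin n) C(Set.Ioc (0 : ℝ) 1, 𝕜))
    (h : ∀ x y, Tendsto (fun ε : Set.Ioc (0 : ℝ) 1 => transport (Matrix.GeneralLinearGroup.map
      (ContinuousMap.evalAlgHom 𝕜 𝕜 ε).toRingHom G) ν x y)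
      (comap Subtype.val (𝓝[>] 0)) (𝓝 (μ x y))) :
    IsContraction μ ν := by
  classical
  let g : Set.Ioc (0 : ℝ) 1 → GL (Fin n) 𝕜 := fun ε =>
    Matrix.GeneralLinearGroup.map (ContinuousMap.evalAlgHom 𝕜 𝕜 ε).toRingHom G
  have hg : Continuous g := by
    refine Units.continuous_iff.2 ⟨?_, ?_⟩
    · exact continuous_matrix fun i j => (ContinuousMap.continuous (G.val i j) :)
    · exact continuous_matrix fun i j => (ContinuousMap.continuous (G⁻¹.val i j) :)
  -- The value 1 outside ]0, 1] is a filler: neither the continuity nor the limit sees it.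
  refine ⟨fun ε => if hε : ε ∈ Set.Ioc (0 : ℝ) 1 then g ⟨ε, hε⟩ else 1, ?_, fun x y => ?_⟩
  · rw [continuousOn_iff_continuous_domRestrict]
    convert hg using 1
    ext1 ε
    simp [ε.2.1, ε.2.2]
  · have hmem : Set.Ioc (0 : ℝ) 1 ∈ 𝓝[>] (0 : ℝ) := Ioc_mem_nhdsGT one_pos
    have hmap : map Subtype.val (comap (Subtype.val : Set.Ioc (0 : ℝ) 1 → ℝ) (𝓝[>] 0)) =
        𝓝[>] 0 := by
      rw [map_comap_of_mem]
      rwa [Subtype.range_coe]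
    rw [← hmap, tendsto_map'_iff]
    refine (h x y).congr fun ε => ?_
    simp only [Function.comp_apply, dif_pos ε.2]
    rfl

theorem IsContraction.of_orbit {μ ν κ : Bracket 𝕜 n} (h : IsContraction μ ν) (hν : ν ∈ orbit κ) :
    IsContraction μ κ := by
  obtain ⟨g, rfl⟩ := hν
  obtain ⟨f, hf, hlim⟩ := h
  refine ⟨fun ε => f ε * g, hf.mul continuousOn_const, fun x y => ?_⟩
  simpa only [transport_mul] using hlim x y

theorem IsContraction.transport_left {μ ν : Bracket 𝕜 n} (h : IsContraction μ ν) (g : GL (Fin n) 𝕜) :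
    IsContraction (transport g μ) ν := by
  obtain ⟨f, hf, hlim⟩ := h
  refine ⟨fun ε => g * f ε, continuousOn_const.mul hf, fun x y => ?_⟩
  simp only [transport_mul, transport_apply g]
  exact ((Matrix.toLin' g.val).continuous_of_finiteDimensional.tendsto _).comp (hlim _ _)

section Algebra

variable {A : Type*} [CommRing A]

/-- The standard basis is anti-triangular for `B`, with `X₇` and `X₈` central and spanning the
derived algebra. -/
structure IsAntitriangular (B : (Fin 8 → A) →ₗ[A] (Fin 8 → A) →ₗ[A] (Fin 8 → A)) : Prop where
  alt : ∀ x, B x x = 0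
  range : ∀ x y k, k ≠ 6 → k ≠ 7 → B x y k = 0
  h6 : ∀ y, B (Pi.single 6 1) y = 0
  h7 : ∀ y, B (Pi.single 7 1) y = 0
  h_zero : ∀ i j : Fin 8, i < j → i.val + j.val < 5 → B (Pi.single i 1) (Pi.single j 1) = 0

/-- The determinant of `p` and `q` in the plane of the last two coordinates. -/
def planeDet (p q : Fin 8 → A) : A := p 6 * q 7 - p 7 * q 6

/-- Unit determinants let any two antidiagonal entries span the plane, so the elimination applies; a
rescaling then normalizes the entries. Working over a general ring makes the frame depend
continuously on a parameter when A is a ring of continuous functions. -/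
theorem IsAntitriangular.exists_isFrame {B : (Fin 8 → A) →ₗ[A] (Fin 8 → A) →ₗ[A] (Fin 8 → A)}
    (h : IsAntitriangular B) {p₁ p₂ p₃ : Fin 8 → A}
    (hp₁ : B (Pi.single 0 1) (Pi.single 5 1) = p₁) (hp₂ : B (Pi.single 1 1) (Pi.single 4 1) = p₂)
    (hp₃ : B (Pi.single 2 1) (Pi.single 3 1) = p₃) (h₁₂ : IsUnit (planeDet p₁ p₂))
    (h₁₃ : IsUnit (planeDet p₁ p₃)) (h₂₃ : IsUnit (planeDet p₂ p₃)) :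
    ∃ b : Fin 8 → Fin 8 → A, IsFrame B b ∧ IsUnit (planeDet (b 6) (b 7)) := by
  -- Two antidiagonal entries span only the plane of the last two coordinates, so the elimination is
  -- run with values in A × A and carried back by ι.
  let π : (Fin 8 → A) →ₗ[A] A × A := (LinearMap.proj 6).prod (LinearMap.proj 7)
  let ι : A × A →ₗ[A] (Fin 8 → A) := (LinearMap.fst A A A).smulRight (Pi.single 6 1) +
    (LinearMap.snd A A A).smulRight (Pi.single 7 1)
  have hι : ∀ x y, ι (π (B x y)) = B x y := by
    intro x y
    ext k
    by_cases h6 : k = 6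
    · subst h6; simp [ι, π]
    by_cases h7 : k = 7
    · subst h7; simp [ι, π]
    rw [h.range _ _ k h6 h7]
    simp [ι, h6, h7]
  have hιp : ∀ {x y p}, B x y = p → ι (π p) = p := fun {x y p} hp => by rw [← hp, hι]
  have hBι : ∀ v y, B (ι v) y = 0 := fun v y => by simp [ι, h.h6, h.h7]
  have hz : ∀ i j : Fin 8, i < j → i.val + j.val < 5 →
      B.compr₂ π (Pi.single i 1) (Pi.single j 1) = 0 := fun i j hij hs => by
    rw [LinearMap.compr₂_apply, h.h_zero i j hij hs, map_zero]
  obtain ⟨e₁, e₂, e₃, f₁, f₂, f₃, h11, h22, h33, he12, he13, he23, hf12, hf13, hf23, h12, h13, h23,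
    h21, h31, h32⟩ := exists_antidiagonal (B.compr₂ π)
      (fun x => by rw [LinearMap.compr₂_apply, h.alt, map_zero])
      (p₁ := π p₁) (p₂ := π p₂) (p₃ := π p₃)
      (span_of_isUnit_det h₁₂) (span_of_isUnit_det h₁₃) (span_of_isUnit_det h₂₃)
      (Pi.single 0 1) (Pi.single 1 1) (Pi.single 2 1)
      (Pi.single 5 1) (Pi.single 4 1) (Pi.single 3 1)
      (by rw [LinearMap.compr₂_apply, hp₁]) (by rw [LinearMap.compr₂_apply, hp₂])
      (by rw [LinearMap.compr₂_apply, hp₃])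
      (hz 0 1 (by decide) (by decide)) (hz 0 2 (by decide) (by decide))
      (hz 1 2 (by decide) (by decide)) (hz 0 4 (by decide) (by decide))
      (hz 0 3 (by decide) (by decide)) (hz 1 3 (by decide) (by decide))
  have hval : ∀ {u v z}, B.compr₂ π u v = π z → ι (π z) = z → B u v = z := fun {u v z} huv hz => by
    rw [← hι, ← LinearMap.compr₂_apply, huv, hz]
  have hval0 : ∀ {u v}, B.compr₂ π u v = 0 → B u v = 0 := fun {u v} huv => by
    rw [← hι, ← LinearMap.compr₂_apply, huv, map_zero]
  have hval0' : ∀ {u v}, B.compr₂ π u v = 0 → B v u = 0 := fun {u v} huv => by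
    rw [alt_neg h.alt u v, hval0 huv, neg_zero]
  obtain ⟨x, y, hxy⟩ : ∃ x y : A, p₃ = x • p₁ + y • p₂ := by
    obtain ⟨x, y, hxy⟩ := span_of_isUnit_det (p := π p₁) (q := π p₂) h₁₂ (π p₃)
    refine ⟨x, y, ?_⟩
    rw [← hιp hp₃, hxy, map_add, map_smul, map_smul, hιp hp₁, hιp hp₂]
  -- From p₃ = x p₁ + y p₂, the determinant of (p₂, p₃) is −x times that of (p₁, p₂), and that of
  -- (p₁, p₃) is y times it.
  have hx : IsUnit x := by
    refine isUnit_of_mul_isUnit_left (y := -planeDet p₁ p₂) ?_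
    convert h₂₃ using 1
    simp only [hxy, planeDet, Pi.add_apply, Pi.smul_apply, smul_eq_mul]
    ring
  have hy : IsUnit y := by
    refine isUnit_of_mul_isUnit_left (y := planeDet p₁ p₂) ?_
    convert h₁₃ using 1
    simp only [hxy, planeDet, Pi.add_apply, Pi.smul_apply, smul_eq_mul]
    ring
  -- Scaling e₁ by x and e₂ by y turns the first two entries into x p₁ and y p₂, whose sum is the
  -- third entry p₃.
  refine ⟨![x • e₁, y • e₂, e₃, f₃, f₂, f₁, x • p₁, y • p₂], ⟨h.alt, ?_, ?_, ?_, ?_, ?_, ?_⟩, ?_⟩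
  · simp [hval h11 (hιp hp₁)]
  · simp [hval h22 (hιp hp₂)]
  · simpa [hxy] using hval h33 (hιp hp₃)
  · intro i j hij hj5 hij5
    fin_cases i <;> fin_cases j <;> first
      | exact absurd hij (by decide)
      | exact absurd hj5 (by decide)
      | exact absurd rfl hij5
      | simp [hval0 he12, hval0 he13, hval0 he23, hval0' hf12, hval0' hf13, hval0' hf23,
          hval0 h12, hval0 h13, hval0 h23, hval0 h21, hval0 h31, hval0 h32]
  · intro v
    have := hBι (π p₁) v
    rw [hιp hp₁] at this
    simp [this]
  · intro v
    have := hBι (π p₂) v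
    rw [hιp hp₂] at this
    simp [this]
  · convert (hx.mul hy).mul h₁₂ using 1
    simp [planeDet]
    ring

end Algebra

theorem IsAntitriangular.add_smul {μ : Bracket ℂ 8} (h : IsAntitriangular μ) (s : ℂ) :
    IsAntitriangular (μ + s • diagonalBracket ℂ) where
  alt x := by simp [diagonalBracket, h.alt, mul_comm]
  range x y k h6 h7 := by simp [diagonalBracket, h.range x y k h6 h7, h6, h7]
  h6 y := by simp [diagonalBracket, h.h6]
  h7 y := by simp [diagonalBracket, h.h7]
  h_zero i j hij hs := by
    rw [LinearMap.add_apply, LinearMap.add_apply, h.h_zero i j hij hs]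
    revert hij hs
    fin_cases i <;> fin_cases j <;> simp [diagonalBracket]

/-- Each determinant is a quadratic polynomial in s. Its leading coefficient is the corresponding
determinant for the model, whose antidiagonal entries (1,0), (0,1), (1,1) are pairwise independent:
hence 1, 1 and −1. -/
theorem eventually_planeDet_ne_zero (μ : Bracket ℂ 8) :
    ∀ᶠ s : ℝ in 𝓝[>] 0, ∀ p₁ p₂ p₃ : Fin 8 → ℂ,
      (μ + (s : ℂ) • diagonalBracket ℂ) (Pi.single 0 1) (Pi.single 5 1) = p₁ →
      (μ + (s : ℂ) • diagonalBracket ℂ) (Pi.single 1 1) (Pi.single 4 1) = p₂ →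
      (μ + (s : ℂ) • diagonalBracket ℂ) (Pi.single 2 1) (Pi.single 3 1) = p₃ →
      planeDet p₁ p₂ ≠ 0 ∧ planeDet p₁ p₃ ≠ 0 ∧ planeDet p₂ p₃ ≠ 0 := by
  let m := fun i j k : Fin 8 => μ (Pi.single i 1) (Pi.single j 1) k
  filter_upwards [eventually_quadratic_ne_zero (a := m 0 5 6 * m 1 4 7 - m 0 5 7 * m 1 4 6)
      (b := m 1 4 7 + m 0 5 6) (c := 1) one_ne_zero,
    eventually_quadratic_ne_zero (a := m 0 5 6 * m 2 3 7 - m 0 5 7 * m 2 3 6)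
      (b := m 2 3 7 + m 0 5 6 - m 0 5 7) (c := 1) one_ne_zero,
    eventually_quadratic_ne_zero (a := m 1 4 6 * m 2 3 7 - m 1 4 7 * m 2 3 6)
      (b := m 1 4 6 - m 1 4 7 - m 2 3 6) (c := -1) (by simp)] with s h1 h2 h3
  rintro _ _ _ rfl rfl rfl
  refine ⟨?_, ?_, ?_⟩
  · convert h1 using 1
    simp [diagonalBracket, m, planeDet]
    ring
  · convert h2 using 1
    simp [diagonalBracket, m, planeDet]
    ring
  · convert h3 using 1
    simp [diagonalBracket, m, planeDet]
    ring

/-- Used to evaluate a frame over continuous functions at a point. Surjectivity is needed because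
the centrality of `b 6` and `b 7` is tested on all vectors over S. -/
theorem IsFrame.map {R S : Type*} [CommRing R] [CommRing S] {φ : R →+* S}
    (hφ : Function.Surjective φ) {c : Fin 8 × Fin 8 × Fin 8 → R} {ν : (Fin 8 → S) →ₗ[S]
    (Fin 8 → S) →ₗ[S] (Fin 8 → S)} (hν : ∀ x, ν x x = 0) (h : ofConstants (φ ∘ c) = ν)
    {b : Fin 8 → Fin 8 → R} (hb : IsFrame (ofConstants c) b) : IsFrame ν (fun j => φ ∘ b j) := by
  have hadd : ∀ u v : Fin 8 → R, φ ∘ (u + v) = φ ∘ u + φ ∘ v := fun u v => by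
    ext k; simp
  have h0 : φ ∘ (0 : Fin 8 → R) = 0 := by ext k; simp
  subst h
  refine ⟨hν, ?_, ?_, ?_, ?_, ?_, ?_⟩
  · rw [← map_ofConstants, hb.h05]
  · rw [← map_ofConstants, hb.h14]
  · rw [← map_ofConstants, hb.h23, hadd]
  · intro i j h1 h2 h3
    rw [← map_ofConstants, hb.h_zero i j h1 h2 h3, h0]
  · intro v
    obtain ⟨v, rfl⟩ := hφ.comp_left v
    rw [← map_ofConstants, hb.h6, h0]
  · intro v
    obtain ⟨v, rfl⟩ := hφ.comp_left v
    rw [← map_ofConstants, hb.h7, h0]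

theorem linearIndependent_of_planeDet_ne_zero {p q : Fin 8 → ℂ} (h : planeDet p q ≠ 0) :
    LinearIndependent ℂ ![p, q] := by
  rw [LinearIndependent.pair_iff]
  intro r r' hr
  have e6 : r * p 6 + r' * q 6 = 0 := by simpa using congrFun hr 6
  have e7 : r * p 7 + r' * q 7 = 0 := by simpa using congrFun hr 7
  unfold planeDet at h
  constructor
  · refine (mul_eq_zero.1 ?_).resolve_right h
    linear_combination q 7 * e6 - q 6 * e7
  · refine (mul_eq_zero.1 ?_).resolve_right h
    linear_combination p 6 * e7 - p 7 * e6

/-- A family of brackets that is anti-triangular at each point is so over the ring of continuous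
functions. -/
theorem isAntitriangular_of_eval {T : Type*} [TopologicalSpace T]
    {c : Fin 8 × Fin 8 × Fin 8 → C(T, ℂ)}
    (h : ∀ τ, IsAntitriangular (ofConstants
      ((ContinuousMap.evalAlgHom ℂ ℂ τ : C(T, ℂ) →ₐ[ℂ] ℂ).toRingHom ∘ c))) :
    IsAntitriangular (ofConstants c) := by
  let ev : T → C(T, ℂ) →+* ℂ := fun τ => (ContinuousMap.evalAlgHom ℂ ℂ τ).toRingHom
  have hext : ∀ {x y : Fin 8 → C(T, ℂ)}, (∀ τ, ev τ ∘ x = ev τ ∘ y) → x = y := fun hxy => by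
    ext k τ
    exact congrFun (hxy τ) k
  have hsingle : ∀ τ (k : Fin 8), ev τ ∘ (Pi.single k 1 : Fin 8 → C(T, ℂ)) = Pi.single k 1 := by
    intro τ k
    ext j
    by_cases hj : j = k
    · subst hj; simp
    · simp [hj]
  have hev0 : ∀ τ, ev τ ∘ (0 : Fin 8 → C(T, ℂ)) = 0 := fun τ => by ext j; simp
  refine ⟨fun x => hext fun τ => ?_, fun x y k h6 h7 => ?_, fun y => hext fun τ => ?_,
    fun y => hext fun τ => ?_, fun i j hij hs => hext fun τ => ?_⟩
  · rw [map_ofConstants, (h τ).alt, hev0]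
  · ext τ
    have := congrFun (map_ofConstants (ev τ) c x y) k
    rw [(h τ).range _ _ k h6 h7] at this
    exact this
  · rw [map_ofConstants, hsingle, (h τ).h6, hev0]
  · rw [map_ofConstants, hsingle, (h τ).h7, hev0]
  · rw [map_ofConstants, hsingle, hsingle, (h τ).h_zero i j hij hs, hev0]

/-- The segment μ + δτ · `diagonalBracket`, 0 < τ ≤ 1, is a single bracket over the continuous
functions on ]0, 1], where a nowhere vanishing function is a unit. Its frame is an invertible matrix
over that ring, that is, a continuous path carrying the model to the segment, which tends to μ. -/
theorem isContraction_diagonalBracket {μ : Bracket ℂ 8} (h : IsAntitriangular μ) :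
    IsContraction μ (diagonalBracket ℂ) := by
  obtain ⟨δ, hδ, hdet⟩ := exists_scale (eventually_planeDet_ne_zero μ)
  let c : Fin 8 × Fin 8 × Fin 8 → C(Set.Ioc (0 : ℝ) 1, ℂ) := fun t =>
    ⟨fun τ => structureConstants μ t +
      ((δ * τ : ℝ) : ℂ) * structureConstants (diagonalBracket ℂ) t, by fun_prop⟩
  let ev : Set.Ioc (0 : ℝ) 1 → C(Set.Ioc (0 : ℝ) 1, ℂ) →+* ℂ := fun τ =>
    (ContinuousMap.evalAlgHom ℂ ℂ τ).toRingHom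
  have hev : ∀ τ f, ev τ f = f τ := fun _ _ => rfl
  have hsurj : ∀ τ, Function.Surjective (ev τ) := fun τ a => ⟨ContinuousMap.const _ a, rfl⟩
  have hc : ∀ τ, ofConstants (ev τ ∘ c) = μ + ((δ * τ : ℝ) : ℂ) • diagonalBracket ℂ := by
    intro τ
    have : ev τ ∘ c = structureConstants μ +
      ((δ * τ : ℝ) : ℂ) • structureConstants (diagonalBracket ℂ) := rfl
    rw [this, ofConstants_add_smul, ofConstants_structureConstants, ofConstants_structureConstants]
  have hunit : ∀ {i j i' j' : Fin 8}, (∀ τ : Set.Ioc (0 : ℝ) 1, planeDet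
      ((μ + ((δ * τ : ℝ) : ℂ) • diagonalBracket ℂ) (Pi.single i 1) (Pi.single j 1))
      ((μ + ((δ * τ : ℝ) : ℂ) • diagonalBracket ℂ) (Pi.single i' 1) (Pi.single j' 1)) ≠ 0) →
      IsUnit (planeDet (ofConstants c (Pi.single i 1) (Pi.single j 1))
        (ofConstants c (Pi.single i' 1) (Pi.single j' 1))) := by
    intro i j i' j' hτ
    rw [ContinuousMap.isUnit_iff_forall_ne_zero]
    intro τ
    have := hτ τ
    rw [← hc, ofConstants_single, ofConstants_single] at this
    rw [ofConstants_single, ofConstants_single]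
    exact this
  obtain ⟨b, hb, hb67⟩ := (isAntitriangular_of_eval (c := c) fun τ =>
      (hc τ).symm ▸ h.add_smul _).exists_isFrame rfl rfl rfl
    (hunit fun τ => (hdet τ τ.2 _ _ _ rfl rfl rfl).1)
    (hunit fun τ => (hdet τ τ.2 _ _ _ rfl rfl rfl).2.1)
    (hunit fun τ => (hdet τ τ.2 _ _ _ rfl rfl rfl).2.2)
  have hframe := fun τ : Set.Ioc (0 : ℝ) 1 => hb.map (hsurj τ) (h.add_smul ((δ * τ : ℝ) : ℂ)).alt (hc τ)
  have hli : ∀ τ, LinearIndependent ℂ (fun j => ev τ ∘ b j) := fun τ =>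
    (hframe τ).linearIndependent <| linearIndependent_of_planeDet_ne_zero
      ((ContinuousMap.isUnit_iff_forall_ne_zero _).1 hb67 τ)
  have hdetb : IsUnit (Matrix.of fun i j => b j i) := by
    rw [Matrix.isUnit_iff_isUnit_det, ContinuousMap.isUnit_iff_forall_ne_zero]
    intro τ h0
    rw [← hev, RingHom.map_det] at h0
    have hu := Matrix.linearIndependent_cols_iff_isUnit
      (A := (ev τ).mapMatrix (Matrix.of fun i j => b j i)).1 (hli τ)
    rw [Matrix.isUnit_iff_isUnit_det, h0] at hu
    exact not_isUnit_zero hu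
  refine isContraction_of_family hdetb.unit fun u v => ?_
  have htrans : ∀ τ : Set.Ioc (0 : ℝ) 1, μ + ((δ * τ : ℝ) : ℂ) • diagonalBracket ℂ =
      transport (Matrix.GeneralLinearGroup.map (ev τ) hdetb.unit) (diagonalBracket ℂ) := by
    intro τ
    refine (hframe τ).eq_transport fun i => ?_
    ext j
    simp
  have hlim : Tendsto (fun ε : ℝ => (μ + ((δ * ε : ℝ) : ℂ) • diagonalBracket ℂ) u v)
      (𝓝[>] 0) (𝓝 (μ u v)) := by
    have : Continuous fun ε : ℝ => μ u v + ((δ * ε : ℝ) : ℂ) • diagonalBracket ℂ u v := by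
      fun_prop
    have := this.tendsto 0
    simp only [mul_zero, Complex.ofReal_zero, zero_smul, add_zero] at this
    exact this.mono_left nhdsWithin_le_nhds
  refine (hlim.comp tendsto_comap).congr fun τ => ?_
  exact LinearMap.congr_fun₂ (htrans τ) u v

end Path

/-! ### The isomorphism of `k8` with the model over ℂ. -/

section K8

theorem k8_alt (𝕜 : Type*) [Field 𝕜] (x : Fin 8 → 𝕜) : k8 𝕜 x x = 0 := by
  ext k
  simp [k8, mul_comm]

theorem k8_mem_twoNilp (𝕜 : Type*) [Field 𝕜] : k8 𝕜 ∈ twoNilp 𝕜 8 :=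
  mem_twoNilp.2 ⟨k8_alt 𝕜, fun x y z => by ext k; simp [k8]⟩

/-- The columns diagonalize `k₈`, for a primitive cube root of unity `ω`. -/
def k8Frame (ω : ℂ) : Fin 8 → Fin 8 → ℂ :=
  ![![-ω, 0, 0, 0, 0, -ω, 0, -ω], ![-ω ^ 2, 0, 0, 0, 0, -ω, 0, -1],
    ![1, 0, 0, 0, 0, ω, 0, ω ^ 2], ![0, -1, 0, ω ^ 2, 0, 0, ω, 0], ![0, -1, 0, ω, 0, 0, ω ^ 2, 0],
    ![0, -1, 0, 1, 0, 0, 1, 0], ![0, 0, -3 * ω, 0, 3 * ω, 0, 0, 0],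
    ![0, 0, -3 * ω ^ 2, 0, 3, 0, 0, 0]]

theorem k8Frame_isFrame {ω : ℂ} (hω : ω ^ 2 + ω + 1 = 0) : IsFrame (k8 ℂ) (k8Frame ω) := by
  refine ⟨k8_alt ℂ, ?_, ?_, ?_, ?_, ?_, ?_⟩
  · ext k
    fin_cases k <;> simp [k8, k8Frame] <;> grind
  · ext k
    fin_cases k <;> simp [k8, k8Frame] <;> grind
  · ext k
    fin_cases k <;> simp [k8, k8Frame] <;> grind
  · intro i j hij hj5 hij5
    ext k
    fin_cases i <;> fin_cases j <;> first
      | exact absurd hij (by decide)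
      | exact absurd hj5 (by decide)
      | exact absurd rfl hij5
      | (fin_cases k <;> simp [k8, k8Frame] <;> grind)
  · intro y
    ext k
    simp [k8, k8Frame]
  · intro y
    ext k
    simp [k8, k8Frame]

/-- On the six non-central coordinates the pencil of `k8` has Pfaffian s³ − t³ up to sign, and that
of the model st(s + t). Each has three distinct roots over ℂ, and the cube roots of unity provide
the explicit frame. -/
theorem diagonalBracket_mem_orbit_k8 : diagonalBracket ℂ ∈ orbit (k8 ℂ) := by
  obtain ⟨ω, hω⟩ : ∃ ω : ℂ, ω ^ 2 + ω + 1 = 0 := by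
    obtain ⟨ω, hω⟩ := IsAlgClosed.exists_root
      (Polynomial.X ^ 2 + Polynomial.X + 1 : Polynomial ℂ) (by
        have : (Polynomial.X ^ 2 + Polynomial.X + 1 : Polynomial ℂ).degree = 2 := by
          compute_degree!
        rw [this]; decide)
    exact ⟨ω, by simpa using hω⟩
  have hf := k8Frame_isFrame hω
  have hli : LinearIndependent ℂ ![k8Frame ω 6, k8Frame ω 7] := by
    rw [LinearIndependent.pair_iff]
    intro s t hst
    have h2 := congrFun hst 2
    have h4 := congrFun hst 4
    simp [k8Frame] at h2 h4
    grind
  obtain ⟨g, hg⟩ := exists_GL_of_linearIndependent (hf.linearIndependent hli)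
  exact mem_orbit_symm ⟨g, hf.eq_transport hg⟩

end K8

/-! ### Pencils of alternating forms: flags and central planes. -/

section Flag

open Module

variable {K V : Type*} [Field K] [AddCommGroup V] [Module K V] [FiniteDimensional K V]

theorem finrank_inf_ker_add_one {H : Submodule K V} {f : V →ₗ[K] K} {v : V} (hv : v ∈ H)
    (hf : f v ≠ 0) : finrank K ↥(H ⊓ LinearMap.ker f) + 1 = finrank K H := by
  have hne : f.domRestrict H ≠ 0 := fun h => hf (LinearMap.congr_fun h ⟨v, hv⟩)
  have := Module.Dual.finrank_ker_add_one_of_ne_zero hne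
  have hmap : (LinearMap.ker (f.domRestrict H)).map H.subtype = H ⊓ LinearMap.ker f := by
    rw [LinearMap.ker_domRestrict, Submodule.map_comap_subtype]
  rw [← this, ← hmap, Submodule.finrank_map_subtype_eq]

/-- Two maps between spaces of the same positive dimension over an algebraically closed field have
a singular combination. -/
theorem exists_singular_combination [IsAlgClosed K] {W : Type*} [AddCommGroup W] [Module K W]
    [FiniteDimensional K W] (φ ψ : V →ₗ[K] W) (hVW : finrank K V = finrank K W)
    (hV : 0 < finrank K V) :
    ∃ (s t : K) (v : V), (s ≠ 0 ∨ t ≠ 0) ∧ v ≠ 0 ∧ s • φ v + t • ψ v = 0 := by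
  by_cases hψ : LinearMap.ker ψ = ⊥
  · have : Nontrivial V := finrank_pos_iff.1 hV
    let e := LinearEquiv.ofInjectiveOfFinrankEq ψ (LinearMap.ker_eq_bot.1 hψ) hVW
    have he : ∀ v, e v = ψ v := fun v => rfl
    obtain ⟨c, hc⟩ := Module.End.exists_eigenvalue (e.symm.toLinearMap ∘ₗ φ)
    obtain ⟨v, hv⟩ := hc.exists_hasEigenvector
    refine ⟨1, -c, v, Or.inl one_ne_zero, hv.2, ?_⟩
    have := congrArg e hv.apply_eq_smul
    rw [LinearMap.comp_apply, LinearEquiv.coe_coe, LinearEquiv.apply_symm_apply, map_smul,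
      he] at this
    rw [this]
    simp
  · obtain ⟨v, hv, hv0⟩ := Submodule.exists_mem_ne_zero_of_ne_bot hψ
    exact ⟨0, 1, v, Or.inr one_ne_zero, hv0, by simpa using hv⟩

theorem exists_coordinates {Z : Submodule K V} (hZ : finrank K Z = 2) :
    ∃ (l₀ l₁ : V →ₗ[K] K) (z₀ z₁ : V), z₀ ∈ Z ∧ z₁ ∈ Z ∧ l₀ z₀ = 1 ∧ l₁ z₀ = 0 ∧ l₀ z₁ = 0 ∧
      l₁ z₁ = 1 ∧ (∀ z ∈ Z, z = l₀ z • z₀ + l₁ z • z₁) := by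
  obtain ⟨π, hπ⟩ := LinearMap.exists_leftInverse_of_injective Z.subtype Z.ker_subtype
  have hπz : ∀ z : Z, π z = z := fun z => LinearMap.congr_fun hπ z
  let b := finBasisOfFinrankEq K Z hZ
  refine ⟨b.coord 0 ∘ₗ π, b.coord 1 ∘ₗ π, b 0, b 1, (b 0).2, (b 1).2, ?_, ?_, ?_, ?_, ?_⟩
  · simp [hπz]
  · simp [hπz]
  · simp [hπz]
  · simp [hπz]
  · intro z hz
    have := congrArg Subtype.val (b.sum_repr ⟨z, hz⟩)
    rw [Fin.sum_univ_two] at this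
    have hz' : π z = ⟨z, hz⟩ := hπz ⟨z, hz⟩
    simp only [LinearMap.comp_apply, hz', Basis.coord_apply]
    exact this.symm

/-- On a complement Q of C in H the two coordinates of B are maps from Q to its dual. A singular
combination of them kills some q ≠ 0, so B q maps H into a line of Z, and its kernel there has
codimension at most one. This q is the new vector e. -/
theorem exists_flag_step [IsAlgClosed K] {B : V →ₗ[K] V →ₗ[K] V} (hB : ∀ x, B x x = 0)
    {Z C H : Submodule K V} (hZ : finrank K Z = 2) (hBZ : ∀ x y, B x y ∈ Z) (hCH : C ≤ H)
    (hC : ∀ c ∈ C, ∀ h ∈ H, B c h = 0) (hdim : finrank K C + 2 ≤ finrank K H) :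
    ∃ e ∈ H, e ∉ C ∧ ∃ H' ≤ H, C ⊔ K ∙ e ≤ H' ∧ finrank K H' + 1 = finrank K H ∧
      ∀ h ∈ H', B e h = 0 := by
  obtain ⟨l₀, l₁, z₀, z₁, hz₀, hz₁, h00, h10, h01, h11, hl⟩ := exists_coordinates hZ
  obtain ⟨D, hD⟩ := C.exists_isCompl
  let Q := D ⊓ H
  have hCQ : C ⊔ Q = H := by
    rw [← sup_inf_assoc_of_le D hCH, hD.sup_eq_top, top_inf_eq]
  have hCQ' : C ⊓ Q = ⊥ := by
    rw [← inf_assoc, hD.inf_eq_bot, bot_inf_eq]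
  have hQ : finrank K C + finrank K Q = finrank K H := by
    rw [← Submodule.finrank_sup_add_finrank_inf_eq, hCQ, hCQ', finrank_bot, add_zero]
  obtain ⟨s, t, q, hst, hq0, hq⟩ := exists_singular_combination
    (((B.compr₂ l₀).domRestrict₁₂ Q Q : Q →ₗ[K] Q →ₗ[K] K) : Q →ₗ[K] Module.Dual K Q)
    (((B.compr₂ l₁).domRestrict₁₂ Q Q : Q →ₗ[K] Q →ₗ[K] K) : Q →ₗ[K] Module.Dual K Q)
    (Subspace.dual_finrank_eq).symm (by omega)
  have hqH : (q : V) ∈ H := q.2.2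
  have hqC : (q : V) ∉ C := fun h => hq0 <| by
    have : (q : V) ∈ C ⊓ Q := ⟨h, q.2⟩
    rw [hCQ'] at this
    simpa using this
  have hline : ∀ h ∈ H, s * l₀ (B q h) + t * l₁ (B q h) = 0 := by
    intro h hh
    rw [← hCQ] at hh
    obtain ⟨c, hc, q', hq', rfl⟩ := Submodule.mem_sup.1 hh
    have h0 : B q c = 0 := by rw [alt_neg hB c, hC c hc _ hqH, neg_zero]
    have := LinearMap.congr_fun hq ⟨q', hq'⟩
    simpa [h0, LinearMap.domRestrict₁₂_apply] using this
  obtain ⟨f, hfC, hfker, v, hvH, hfv⟩ : ∃ f : V →ₗ[K] K, C ⊔ K ∙ (q : V) ≤ LinearMap.ker f ∧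
      (∀ h ∈ H, f h = 0 → B q h = 0) ∧ ∃ v ∈ H, f v ≠ 0 := by
    -- If q is orthogonal to all of H, any hyperplane of H containing C and q serves; one exists
    -- because C has codimension at least 2 in H. Otherwise a coordinate of B q whose companion has
    -- a nonzero coefficient in the relation cuts out the kernel.
    by_cases h : ∀ h ∈ H, B q h = 0
    · have hlt : C ⊔ K ∙ (q : V) < H := by
        refine lt_of_le_of_ne (sup_le hCH ((Submodule.span_singleton_le_iff_mem _ _).2 hqH)) ?_
        intro heq
        have h1 := Submodule.finrank_add_le_finrank_add_finrank C (K ∙ (q : V))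
        rw [heq] at h1
        have h2 := finrank_span_singleton (K := K) (v := (q : V)) (by simpa using hq0)
        omega
      obtain ⟨v, hvH, hv⟩ := SetLike.exists_of_lt hlt
      obtain ⟨f, hfv, hf⟩ := Submodule.exists_le_ker_of_notMem hv
      exact ⟨f, hf, fun x hx _ => h x hx, v, hvH, hfv⟩
    · push Not at h
      obtain ⟨v, hvH, hv⟩ := h
      have hin : ∀ l : V →ₗ[K] K, C ⊔ K ∙ (q : V) ≤ LinearMap.ker (l ∘ₗ B q) := by
        intro l
        refine sup_le (fun c hc => ?_) ((Submodule.span_singleton_le_iff_mem _ _).2 ?_)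
        · simp [alt_neg hB c, hC c hc _ hqH]
        · simp [hB]
      by_cases hs : s = 0
      · have ht : t ≠ 0 := by simpa [hs] using hst
        have h1 : ∀ h ∈ H, l₁ (B q h) = 0 := fun h hh => by simpa [hs, ht] using hline h hh
        have h0 : ∀ h ∈ H, l₀ (B q h) = 0 → B q h = 0 := fun h hh h0 => by
          rw [hl _ (hBZ q h), h0, h1 h hh, zero_smul, zero_smul, add_zero]
        exact ⟨l₀ ∘ₗ B q, hin l₀, h0, v, hvH, fun h => hv (h0 v hvH h)⟩
      · have h0 : ∀ h ∈ H, l₁ (B q h) = 0 → B q h = 0 := fun h hh h1 => by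
          have h0 : l₀ (B q h) = 0 := by simpa [h1, hs] using hline h hh
          rw [hl _ (hBZ q h), h0, h1, zero_smul, zero_smul, add_zero]
        exact ⟨l₁ ∘ₗ B q, hin l₁, h0, v, hvH, fun h => hv (h0 v hvH h)⟩
  exact ⟨q, hqH, hqC, H ⊓ LinearMap.ker f, inf_le_left,
    le_inf (sup_le hCH ((Submodule.span_singleton_le_iff_mem _ _).2 hqH)) hfC,
    finrank_inf_ker_add_one hvH hfv, fun h hh => hfker h hh.1 hh.2⟩

theorem finrank_sup_span_singleton {C : Submodule K V} {e : V} (he : e ∉ C) :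
    finrank K ↥(C ⊔ K ∙ e) = finrank K C + 1 := by
  have h0 : e ≠ 0 := fun h => he (h ▸ C.zero_mem)
  have := Submodule.finrank_sup_add_finrank_inf_eq C (K ∙ e)
  rw [(Submodule.disjoint_span_singleton' h0).2 he |>.eq_bot, finrank_bot,
    finrank_span_singleton h0] at this
  omega

/-- An anti-triangular frame for an alternating product with values in a central plane. -/
theorem exists_antitriangular_frame [IsAlgClosed K] {B : V →ₗ[K] V →ₗ[K] V}
    (hB : ∀ x, B x x = 0) {Z : Submodule K V} (hZ : finrank K Z = 2) (hBZ : ∀ x y, B x y ∈ Z)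
    (hZB : ∀ z ∈ Z, ∀ y, B z y = 0) (hV : finrank K V = 8) :
    ∃ b : Fin 8 → V, LinearIndependent K b ∧ b 6 ∈ Z ∧ b 7 ∈ Z ∧
      (∀ z ∈ Z, ∃ s t : K, z = s • b 6 + t • b 7) ∧
      ∀ i j : Fin 8, i < j → i.val + j.val < 5 → B (b i) (b j) = 0 := by
  have hnext : ∀ {C H H' : Submodule K V} {e : V}, (∀ c ∈ C, ∀ h ∈ H, B c h = 0) → H' ≤ H →
      (∀ h ∈ H', B e h = 0) → ∀ c ∈ C ⊔ K ∙ e, ∀ h ∈ H', B c h = 0 := by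
    intro C H H' e hC hH he c hc h hh
    obtain ⟨c, hcC, c', hc', rfl⟩ := Submodule.mem_sup.1 hc
    obtain ⟨a, rfl⟩ := Submodule.mem_span_singleton.1 hc'
    simp [hC c hcC h (hH hh), he h hh]
  have hmem : ∀ {C : Submodule K V} {e : V}, e ∈ C ⊔ K ∙ e := fun {C e} =>
    Submodule.mem_sup_right (Submodule.mem_span_singleton_self e)
  have hC0 : ∀ c ∈ Z, ∀ h ∈ (⊤ : Submodule K V), B c h = 0 := fun c hc h _ => hZB c hc h
  have ht : finrank K (⊤ : Submodule K V) = 8 := by rw [finrank_top, hV]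
  -- The dimensions of (C, H) run through (2, 8), (3, 7), (4, 6), (5, 5). The fᵢ are then chosen in
  -- the successive differences of the spaces H.
  obtain ⟨e₁, -, he₁, H₁, hH₁, hCH₁, hr₁, hB₁⟩ := exists_flag_step hB hZ hBZ le_top hC0 (by omega)
  have hC1 := hnext hC0 hH₁ hB₁
  have hd₁ := finrank_sup_span_singleton he₁
  obtain ⟨e₂, he₂', he₂, H₂, hH₂, hCH₂, hr₂, hB₂⟩ :=
    exists_flag_step hB hZ hBZ hCH₁ hC1 (by omega)
  have hC2 := hnext hC1 hH₂ hB₂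
  have hd₂ := finrank_sup_span_singleton he₂
  obtain ⟨e₃, he₃', he₃, H₃, hH₃, hCH₃, hr₃, hB₃⟩ :=
    exists_flag_step hB hZ hBZ hCH₂ hC2 (by omega)
  obtain ⟨f₃, hf₃', hf₃⟩ := SetLike.exists_of_lt (lt_of_le_of_ne hH₃ (fun h => by
    rw [h] at hr₃; omega))
  obtain ⟨f₂, hf₂', hf₂⟩ := SetLike.exists_of_lt (lt_of_le_of_ne hH₂ (fun h => by
    rw [h] at hr₂; omega))
  obtain ⟨f₁, -, hf₁⟩ := SetLike.exists_of_lt (lt_of_le_of_ne hH₁ (fun h => by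
    rw [h] at hr₁; omega))
  obtain ⟨l₀, l₁, z₀, z₁, hz₀, hz₁, h00, h10, h01, h11, hl⟩ := exists_coordinates hZ
  have he₁C : e₁ ∈ Z ⊔ K ∙ e₁ ⊔ K ∙ e₂ := Submodule.mem_sup_left hmem
  have hZ₃ : Z ≤ H₃ := (le_sup_left.trans (le_sup_left.trans le_sup_left)).trans hCH₃
  have he₁H : e₁ ∈ H₃ := hCH₃ (Submodule.mem_sup_left he₁C)
  have he₂H : e₂ ∈ H₃ := hCH₃ (Submodule.mem_sup_left hmem)
  have he₃H : e₃ ∈ H₃ := hCH₃ hmem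
  have hspan : ∀ {n} {v : Fin n → V} {H : Submodule K V} {x : V}, (∀ i, v i ∈ H) → x ∉ H →
      x ∉ Submodule.span K (Set.range v) := fun hv hx h =>
    hx (Submodule.span_le.2 (by rintro _ ⟨i, rfl⟩; exact hv i) h)
  have hli : LinearIndependent K ![f₁, f₂, f₃, e₃, e₂, e₁, z₀, z₁] := by
    refine .finCons (.finCons (.finCons (.finCons (.finCons (.finCons ?_
      (hspan ?_ he₁)) (hspan ?_ he₂)) (hspan ?_ he₃)) (hspan ?_ hf₃)) (hspan ?_ hf₂)) (hspan ?_ hf₁)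
    · rw [LinearIndependent.pair_iff]
      intro s t hst
      have h0 := congrArg l₀ hst
      have h1 := congrArg l₁ hst
      simp only [map_add, map_smul, h00, h01, h10, h11, map_zero, smul_eq_mul] at h0 h1
      exact ⟨by simpa using h0, by simpa using h1⟩
    · simp [Fin.forall_fin_succ, hz₀, hz₁]
    · have : Z ≤ Z ⊔ K ∙ e₁ := le_sup_left
      simp [Fin.forall_fin_succ, this hz₀, this hz₁, hmem]
    · have : Z ≤ Z ⊔ K ∙ e₁ ⊔ K ∙ e₂ := le_sup_left.trans le_sup_left
      simp [Fin.forall_fin_succ, this hz₀, this hz₁, hmem, he₁C]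
    · simp [Fin.forall_fin_succ, he₁H, he₂H, he₃H, hZ₃ hz₀, hZ₃ hz₁]
    · simp [Fin.forall_fin_succ, hH₃ he₁H, hH₃ he₂H, hH₃ he₃H, hH₃ (hZ₃ hz₀), hH₃ (hZ₃ hz₁), hf₃']
    · simp [Fin.forall_fin_succ, hH₂ (hH₃ he₁H), hH₂ (hH₃ he₂H), hH₂ (hH₃ he₃H),
        hH₂ (hH₃ (hZ₃ hz₀)), hH₂ (hH₃ (hZ₃ hz₁)), hH₂ hf₃', hf₂']
  refine ⟨![e₁, e₂, e₃, f₃, f₂, f₁, z₀, z₁], ?_, hz₀, hz₁, fun z hz => ⟨_, _, hl z hz⟩, ?_⟩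
  · convert hli.comp ![5, 4, 3, 2, 1, 0, 6, 7] (by decide) using 1
    ext i
    fin_cases i <;> rfl
  · intro i j hij hs
    fin_cases i <;> fin_cases j <;> first
      | exact absurd hij (by decide)
      | exact absurd hs (by decide)
      | skip
    · exact hB₁ _ (hH₂ (hH₃ he₂H))
    · exact hB₁ _ (hH₂ (hH₃ he₃H))
    · exact hB₁ _ (hH₂ hf₃')
    · exact hB₁ _ hf₂'
    · exact hB₂ _ (hH₃ he₃H)
    · exact hB₂ _ hf₃'

/-- An alternating form on an even-dimensional space with a nonzero vector in its radical has a
radical of dimension at least two. -/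
theorem exists_radical_notMem_span [CharZero K] {ω : V →ₗ[K] V →ₗ[K] K} (hω : ∀ x, ω x x = 0)
    {z : V} (hz0 : z ≠ 0) (hz : ∀ y, ω z y = 0) (hV : Even (finrank K V)) :
    ∃ w, w ∉ K ∙ z ∧ ∀ y, ω w y = 0 := by
  obtain ⟨D, hD⟩ := (K ∙ z).exists_isCompl
  have hdim := Submodule.finrank_add_eq_of_isCompl hD
  rw [finrank_span_singleton hz0] at hdim
  let q := finBasis K D
  let M : Matrix (Fin (finrank K D)) (Fin (finrank K D)) K := fun i j => ω (q j) (q i)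
  have hodd : Odd (finrank K D) := by
    rw [← hdim] at hV
    rcases Nat.even_or_odd (finrank K D) with h | h
    · exact absurd hV (by rw [Nat.even_add]; simp [h])
    · exact h
  -- A skew-symmetric matrix of odd order is singular in characteristic zero.
  have hM : M.det = 0 := by
    have h1 : M.transpose = -M := by
      ext i j
      exact alt_neg hω (q j : V) (q i)
    have h2 := M.det_transpose
    rw [h1, Matrix.det_neg, Fintype.card_fin, hodd.neg_one_pow, neg_one_mul] at h2
    exact self_eq_neg.1 h2.symm
  obtain ⟨c, hc0, hc⟩ := Matrix.exists_mulVec_eq_zero_iff.2 hM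
  let w : D := ∑ j, c j • q j
  have hw0 : w ≠ 0 := fun h => hc0 <| by
    have := Fintype.linearIndependent_iff.1 q.linearIndependent c h
    exact funext this
  have hwq : ω.domRestrict₁₂ D D w = 0 := by
    refine q.ext fun i => ?_
    have := congrFun hc i
    simpa [M, Matrix.mulVec, dotProduct, w, mul_comm, LinearMap.domRestrict₁₂_apply] using this
  refine ⟨w, fun hw => hw0 ?_, fun y => ?_⟩
  · have : (w : V) ∈ K ∙ z ⊓ D := ⟨hw, w.2⟩
    rw [hD.inf_eq_bot] at this
    simpa using this
  · have hy : y ∈ K ∙ z ⊔ D := by rw [hD.sup_eq_top]; trivial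
    obtain ⟨y₁, hy₁, y₂, hy₂, rfl⟩ := Submodule.mem_sup.1 hy
    obtain ⟨a, rfl⟩ := Submodule.mem_span_singleton.1 hy₁
    have := LinearMap.congr_fun hwq ⟨y₂, hy₂⟩
    simp only [LinearMap.domRestrict₁₂_apply, LinearMap.zero_apply] at this
    rw [map_add, map_smul, alt_neg hω z, hz, this]
    simp

/-- A derived algebra of dimension 2 is itself such a plane. Otherwise μ is one alternating form
times a central vector z; its radical contains z, and since 8 is even it contains a second
independent vector. -/
theorem exists_central_plane {𝕜 : Type*} [Field 𝕜] [CharZero 𝕜] {μ : Bracket 𝕜 8}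
    (h : μ ∈ twoNilp 𝕜 8) (hd : finrank 𝕜 (derived μ) ≤ 2) :
    ∃ Z : Submodule 𝕜 (Fin 8 → 𝕜), finrank 𝕜 Z = 2 ∧ derived μ ≤ Z ∧ ∀ z ∈ Z, ∀ y, μ z y = 0 := by
  by_cases hd2 : finrank 𝕜 (derived μ) = 2
  · exact ⟨derived μ, hd2, le_rfl, fun z hz => derived_central h hz⟩
  obtain ⟨z, hz0, hzc, hzd⟩ : ∃ z ≠ 0, (∀ y, μ z y = 0) ∧ derived μ ≤ 𝕜 ∙ z := by
    by_cases hbot : derived μ = ⊥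
    -- For the zero bracket any nonzero vector will do.
    · refine ⟨Pi.single 0 1, by simp, fun y => ?_, by simp [hbot]⟩
      have := mem_derived μ (Pi.single 0 1) y
      rwa [hbot, Submodule.mem_bot] at this
    · obtain ⟨z, hz, hz0⟩ := Submodule.exists_mem_ne_zero_of_ne_bot hbot
      refine ⟨z, hz0, derived_central h hz, ?_⟩
      refine (Submodule.eq_of_le_of_finrank_le
        ((Submodule.span_singleton_le_iff_mem _ _).2 hz) ?_).ge
      rw [finrank_span_singleton hz0]
      omega
  obtain ⟨l, hl⟩ := Projective.exists_dual_eq_one 𝕜 hz0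
  obtain ⟨w, hw, hwc⟩ := exists_radical_notMem_span (ω := μ.compr₂ l) (by simp [h.1.1]) hz0
    (by simp [hzc]) (by rw [finrank_fin_fun]; decide)
  refine ⟨𝕜 ∙ z ⊔ 𝕜 ∙ w, ?_, hzd.trans le_sup_left, fun v hv y => ?_⟩
  · rw [finrank_sup_span_singleton hw, finrank_span_singleton hz0]
  · have hwy : μ w y = 0 := by
      obtain ⟨a, ha⟩ := Submodule.mem_span_singleton.1 (hzd (mem_derived μ w y))
      have := hwc y
      rw [LinearMap.compr₂_apply, ← ha, map_smul, hl, smul_eq_mul, mul_one] at this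
      rw [← ha, this, zero_smul]
    obtain ⟨v₁, h₁, v₂, h₂, rfl⟩ := Submodule.mem_sup.1 hv
    obtain ⟨a, rfl⟩ := Submodule.mem_span_singleton.1 h₁
    obtain ⟨c, rfl⟩ := Submodule.mem_span_singleton.1 h₂
    simp [hzc, hwy]

/-- Over `ℂ`, every two-step nilpotent bracket on an eight-dimensional space whose derived algebra
has dimension at most two is a contraction of `k₈`. -/
theorem isContraction_k8 {μ : Bracket ℂ 8} (h : μ ∈ twoNilp ℂ 8)
    (hd : finrank ℂ (derived μ) ≤ 2) : IsContraction μ (k8 ℂ) := by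
  obtain ⟨Z, hZ, hdZ, hZc⟩ := exists_central_plane h hd
  obtain ⟨b, hli, h6, h7, hspan, htri⟩ := exists_antitriangular_frame h.1.1 hZ
    (fun x y => hdZ (mem_derived μ x y)) hZc (by simp)
  obtain ⟨g, hg⟩ := exists_GL_of_linearIndependent hli
  have hg' : ∀ i, (g⁻¹).val.mulVec (b i) = Pi.single i 1 := fun i => by rw [← hg, GL_inv_mulVec]
  have hν : ∀ x y, transport g⁻¹ μ x y =
      (g⁻¹).val.mulVec (μ (g.val.mulVec x) (g.val.mulVec y)) := fun x y => by
    rw [transport_apply, inv_inv]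
  have htri' : IsAntitriangular (transport g⁻¹ μ) := by
    refine ⟨fun x => ?_, fun x y k hk6 hk7 => ?_, fun y => ?_, fun y => ?_, fun i j hij hs => ?_⟩
    · rw [hν, h.1.1, Matrix.mulVec_zero]
    · obtain ⟨s, t, hst⟩ := hspan _ (hdZ (mem_derived μ (g.val.mulVec x) (g.val.mulVec y)))
      rw [hν, hst, Matrix.mulVec_add, Matrix.mulVec_smul, Matrix.mulVec_smul, hg', hg']
      simp [hk6, hk7]
    · rw [hν, hg, hZc _ h6, Matrix.mulVec_zero]
    · rw [hν, hg, hZc _ h7, Matrix.mulVec_zero]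
    · rw [hν, hg, hg, htri i j hij hs, Matrix.mulVec_zero]
  have := ((isContraction_diagonalBracket htri').of_orbit diagonalBracket_mem_orbit_k8).transport_left g
  rwa [← transport_mul, mul_inv_cancel, transport_one] at this

end Flag

/-! ### Zariski closure and semicontinuity of the derived algebra. -/

section Closure

open Module

theorem mem_zariskiClosure_iff {𝕜 : Type*} [Field 𝕜] {n : ℕ} {S : Set (Bracket 𝕜 n)}
    {μ : Bracket 𝕜 n} : μ ∈ zariskiClosure S ↔ μ ∈ twoNilp 𝕜 n ∧
      ∀ p : MvPolynomial (Fin n × Fin n × Fin n) 𝕜,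
        (∀ ν ∈ S, p.eval (structureConstants ν) = 0) → p.eval (structureConstants μ) = 0 := by
  simp [zariskiClosure, MvPolynomial.mem_zeroLocus_iff, MvPolynomial.mem_vanishingIdeal_iff,
    MvPolynomial.aeval_eq_eval]

theorem zariskiClosure_mono {𝕜 : Type*} [Field 𝕜] {n : ℕ} {S T : Set (Bracket 𝕜 n)}
    (h : S ⊆ T) : zariskiClosure S ⊆ zariskiClosure T := fun μ hμ => by
  rw [mem_zariskiClosure_iff] at *
  exact ⟨hμ.1, fun p hp => hμ.2 p fun ν hν => hp ν (h hν)⟩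

theorem zariskiClosure_subset_of_subset {𝕜 : Type*} [Field 𝕜] {n : ℕ} {S T : Set (Bracket 𝕜 n)}
    (h : S ⊆ zariskiClosure T) : zariskiClosure S ⊆ zariskiClosure T := fun μ hμ => by
  rw [mem_zariskiClosure_iff] at *
  exact ⟨hμ.1, fun p hp => hμ.2 p fun ν hν => (mem_zariskiClosure_iff.1 (h hν)).2 p hp⟩

variable {𝕜 : Type*} [Field 𝕜] {n : ℕ}

/-- Shows that, for fixed l, x and y, the value is polynomial in the structure constants. -/
theorem functional_bracket (l : (Fin n → 𝕜) →ₗ[𝕜] 𝕜) (μ : Bracket 𝕜 n) (x y : Fin n → 𝕜) :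
    l (μ x y) = ∑ k, (∑ i, ∑ j, x i * y j * structureConstants μ (i, j, k)) *
      l (Pi.single k 1) := by
  conv_lhs => rw [← ofConstants_structureConstants μ, LinearMap.pi_apply_eq_sum_univ l]
  refine Finset.sum_congr rfl fun k _ => ?_
  rw [ofConstants_apply, smul_eq_mul]
  congr 2
  ext j
  simp [Pi.single_apply, eq_comm]

/-- The dimension of the derived algebra does not increase in a Zariski closure. -/
theorem finrank_derived_le_of_mem_zariskiClosure {S : Set (Bracket 𝕜 n)} {d : ℕ}
    (hS : ∀ ν ∈ S, finrank 𝕜 (derived ν) ≤ d) {μ : Bracket 𝕜 n} (hμ : μ ∈ zariskiClosure S) :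
    finrank 𝕜 (derived μ) ≤ d := by
  by_contra! hd
  obtain ⟨v, hv, -, hli⟩ := Submodule.exists_fun_fin_finrank_span_eq 𝕜 {z | ∃ x y, μ x y = z}
  choose x y hxy using hv
  let w : Fin (d + 1) → Fin n → 𝕜 := fun a => v ⟨a, lt_of_lt_of_le a.2 hd⟩
  have hw : LinearIndependent 𝕜 w := hli.comp _ fun a b hab => by
    simpa [Fin.ext_iff] using hab
  let l : Fin (d + 1) → (Fin n → 𝕜) →ₗ[𝕜] 𝕜 := fun a =>
    ((Basis.span hw).coord a) ∘ₗ (LinearMap.exists_leftInverse_of_injective _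
      (Submodule.span 𝕜 (Set.range w)).ker_subtype).choose
  have hl : ∀ a b, l a (w b) = if b = a then 1 else 0 := by
    intro a b
    have h1 := (LinearMap.exists_leftInverse_of_injective _
      (Submodule.span 𝕜 (Set.range w)).ker_subtype).choose_spec
    have h2 := LinearMap.congr_fun h1 (Basis.span hw b)
    rw [LinearMap.comp_apply, Submodule.subtype_apply, Basis.span_apply] at h2
    simp [l, h2, Finsupp.single_apply]
  let x' : Fin (d + 1) → Fin n → 𝕜 := fun a => x ⟨a, lt_of_lt_of_le a.2 hd⟩
  let y' : Fin (d + 1) → Fin n → 𝕜 := fun a => y ⟨a, lt_of_lt_of_le a.2 hd⟩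
  -- The determinant of P tests the independence of d + 1 products: it vanishes on S by the bound on
  -- the derived algebra, but equals 1 at μ, where the functionals `l a` are dual to the products.
  let P : Matrix (Fin (d + 1)) (Fin (d + 1)) (MvPolynomial (Fin n × Fin n × Fin n) 𝕜) :=
    fun a b => ∑ k, (∑ i, ∑ j, MvPolynomial.C (x' b i) * MvPolynomial.C (y' b j) *
      MvPolynomial.X (i, j, k)) * MvPolynomial.C (l a (Pi.single k 1))
  have hP : ∀ ν : Bracket 𝕜 n, P.det.eval (structureConstants ν) =
      (Matrix.of fun a b => l a (ν (x' b) (y' b))).det := by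
    intro ν
    rw [RingHom.map_det]
    congr 1
    ext a b
    rw [Matrix.of_apply, functional_bracket (l a) ν, RingHom.mapMatrix_apply, Matrix.map_apply]
    simp [P]
  have h0 := (mem_zariskiClosure_iff.1 hμ).2 P.det fun ν hν => by
    rw [hP]
    by_contra hne
    have hu : IsUnit (Matrix.of fun a b => l a (ν (x' b) (y' b))) := by
      rw [Matrix.isUnit_iff_isUnit_det]
      exact isUnit_iff_ne_zero.2 hne
    have hcols := Matrix.linearIndependent_cols_iff_isUnit.2 hu
    have hνli : LinearIndependent 𝕜 fun b => ν (x' b) (y' b) :=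
      LinearIndependent.of_comp (LinearMap.pi l) hcols
    have hνli' : LinearIndependent 𝕜 fun b => (⟨ν (x' b) (y' b), mem_derived ν _ _⟩ : derived ν) :=
      LinearIndependent.of_comp (derived ν).subtype hνli
    have := hνli'.fintype_card_le_finrank
    rw [Fintype.card_fin] at this
    have := hS ν hν
    omega
  rw [hP] at h0
  have : (Matrix.of fun a b => l a (μ (x' b) (y' b))) = 1 := by
    ext a b
    have : μ (x' b) (y' b) = w b := hxy _
    rw [Matrix.of_apply, this, hl, Matrix.one_apply]
    simp [eq_comm]
  rw [this, Matrix.det_one] at h0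
  exact one_ne_zero h0

end Closure

/-! ### Polynomials vanishing on an orbit: pullback to matrices and passage to ℂ. -/

section Density

variable {R S : Type*} [CommRing R] [CommRing S] {n : ℕ}

/-- The structure constants of the product `(x, y) ↦ M (adj M x · adj M y)`. -/
def adjugateConstants (c : Fin n × Fin n × Fin n → R) (M : Matrix (Fin n) (Fin n) R) :
    Fin n × Fin n × Fin n → R := fun t =>
  M.mulVec (ofConstants c (fun a => M.adjugate a t.1) (fun a => M.adjugate a t.2.1)) t.2.2

theorem map_adjugateConstants (φ : R →+* S) (c : Fin n × Fin n × Fin n → R)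
    (M : Matrix (Fin n) (Fin n) R) (t : Fin n × Fin n × Fin n) :
    φ (adjugateConstants c M t) = adjugateConstants (φ ∘ c) (φ.mapMatrix M) t := by
  unfold adjugateConstants
  rw [← RingHom.map_adjugate]
  have := map_ofConstants φ c (fun a => M.adjugate a t.1) (fun a => M.adjugate a t.2.1)
  simp only [Matrix.mulVec, dotProduct, map_sum, map_mul, RingHom.mapMatrix_apply, Matrix.map_apply]
  refine Finset.sum_congr rfl fun k _ => ?_
  exact congrArg (φ (M t.2.2 k) * ·) (congrFun this k)

variable {𝕜 : Type*} [Field 𝕜]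

theorem adjugateConstants_eq (g : GL (Fin n) 𝕜) (μ : Bracket 𝕜 n) :
    adjugateConstants (structureConstants μ) g.val =
      structureConstants (g.val.det ^ 2 • transport g μ) := by
  have hcol : ∀ i, (fun a => g.val.adjugate a i) =
      g.val.det • (g⁻¹).val.mulVec (Pi.single i 1) := by
    intro i
    ext a
    have hd : g.val.det ≠ 0 := ((Matrix.isUnit_iff_isUnit_det _).1 g.isUnit).ne_zero
    simp [Matrix.coe_units_inv, Matrix.inv_def, hd]
  ext ⟨i, j, k⟩
  simp only [adjugateConstants, ofConstants_structureConstants, hcol, structureConstants,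
    LinearMap.smul_apply, transport_apply, map_smul, Matrix.mulVec_smul, smul_smul, pow_two]

theorem exists_scalar_transport {c : 𝕜} (hc : c ≠ 0) : ∃ g : GL (Fin n) 𝕜, g.val.det = c ^ n ∧
    ∀ μ : Bracket 𝕜 n, transport g μ = c⁻¹ • μ := by
  let g : GL (Fin n) 𝕜 := Units.map (Matrix.scalar (Fin n)).toMonoidHom (Units.mk0 c hc)
  have hg : ∀ x, g.val.mulVec x = c • x := fun x => by simp [g]
  refine ⟨g, by simp [g, Matrix.scalar], fun μ => ?_⟩
  symm
  refine eq_transport_iff.2 fun x y => ?_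
  simp [hg, smul_smul, hc]

/-- Scalar matrices rescale brackets, so replacing inverses by adjugates, which costs a factor det²,
does not leave the orbit. -/
theorem smul_transport_mem_orbit {c : 𝕜} (hc : c ≠ 0) (g : GL (Fin n) 𝕜) (μ : Bracket 𝕜 n) :
    c • transport g μ ∈ orbit μ := by
  obtain ⟨h, -, hh⟩ := exists_scalar_transport (n := n) (inv_ne_zero hc)
  exact ⟨h * g, by rw [transport_mul, hh, inv_inv]⟩

/-- The pullback of a polynomial in the structure constants along
`g ↦ det (g) ^ 2 • transport g μ`. -/
def orbitPullback (c : Fin n × Fin n × Fin n → 𝕜)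
    (p : MvPolynomial (Fin n × Fin n × Fin n) 𝕜) : MvPolynomial (Fin n × Fin n) 𝕜 :=
  p.eval₂ MvPolynomial.C (adjugateConstants (MvPolynomial.C ∘ c) (Matrix.mvPolynomialX _ _ 𝕜))

theorem eval₂_orbitPullback (c : Fin n × Fin n × Fin n → 𝕜)
    (p : MvPolynomial (Fin n × Fin n × Fin n) 𝕜) (ψ : 𝕜 →+* S) (M : Matrix (Fin n) (Fin n) S) :
    (orbitPullback c p).eval₂ ψ (fun t => M t.1 t.2) = p.eval₂ ψ (adjugateConstants (ψ ∘ c) M) := by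
  have hM : (MvPolynomial.eval₂Hom ψ (fun t : Fin n × Fin n => M t.1 t.2)).mapMatrix
      (Matrix.mvPolynomialX _ _ 𝕜) = M := by
    ext i j
    simp
  have hψ : (MvPolynomial.eval₂Hom ψ (fun t : Fin n × Fin n => M t.1 t.2)).comp
      MvPolynomial.C = ψ := by
    ext a; simp
  rw [orbitPullback, ← MvPolynomial.coe_eval₂Hom, MvPolynomial.hom_eval₂, hψ]
  congr 1
  ext t
  have h1 := map_adjugateConstants (MvPolynomial.eval₂Hom ψ (fun t : Fin n × Fin n => M t.1 t.2))
    (MvPolynomial.C ∘ c) (Matrix.mvPolynomialX _ _ 𝕜) t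
  have h2 : MvPolynomial.eval₂Hom ψ (fun t : Fin n × Fin n => M t.1 t.2) ∘
      (MvPolynomial.C ∘ c) = ψ ∘ c := by
    ext a; simp
  rw [hM, h2] at h1
  exact h1

/-- A polynomial over an infinite field that vanishes on the orbit of a bracket vanishes on the
orbit of its complexification. -/
theorem eval₂_orbit_eq_zero [Infinite 𝕜] (φ : 𝕜 →+* ℂ) {μ : Bracket 𝕜 8} {ν : Bracket ℂ 8}
    (hν : structureConstants ν = φ ∘ structureConstants μ)
    {p : MvPolynomial (Fin 8 × Fin 8 × Fin 8) 𝕜}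
    (hp : ∀ κ ∈ orbit μ, p.eval (structureConstants κ) = 0) {κ : Bracket ℂ 8} (hκ : κ ∈ orbit ν) :
    p.eval₂ φ (structureConstants κ) = 0 := by
  have hq : orbitPullback (structureConstants μ) p = 0 := by
    -- Multiplying by the generic determinant makes the evaluation vanish at singular matrices too;
    -- over an infinite field the product is then zero, and the determinant can be cancelled.
    refine (mul_eq_zero.1 (?_ : (Matrix.mvPolynomialX _ _ 𝕜).det *
      orbitPullback (structureConstants μ) p = 0)).resolve_left
      (Matrix.det_mvPolynomialX_ne_zero (Fin 8) 𝕜)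
    refine MvPolynomial.funext fun x => ?_
    let M : Matrix (Fin 8) (Fin 8) 𝕜 := Matrix.of fun i j => x (i, j)
    rw [map_mul, Matrix.eval_det_mvPolynomialX, map_zero]
    by_cases hM : M.det = 0
    · exact mul_eq_zero_of_left hM _
    · refine mul_eq_zero_of_right _ ?_
      have h1 := eval₂_orbitPullback (structureConstants μ) p (RingHom.id 𝕜) M
      let g : GL (Fin 8) 𝕜 := Matrix.GeneralLinearGroup.mkOfDetNeZero M hM
      have hg : g.val = M := rfl
      rw [RingHom.coe_id, Function.id_comp, ← hg, adjugateConstants_eq] at h1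
      have h2 := hp _ (smul_transport_mem_orbit (pow_ne_zero 2 hM) g μ)
      exact h1.trans h2
  obtain ⟨h, rfl⟩ := hκ
  have hd : h.val.det ≠ 0 := ((Matrix.isUnit_iff_isUnit_det _).1 h.isUnit).ne_zero
  -- Replacing h by ch multiplies det² by c¹⁶ and the bracket by c⁻¹, so c¹⁵ = det(h)⁻² removes the
  -- factor det² exactly.
  obtain ⟨c, hc⟩ := IsAlgClosed.exists_pow_nat_eq (h.val.det ^ 2)⁻¹ (n := 15) (by norm_num)
  have hc0 : c ≠ 0 := by
    rintro rfl
    exact inv_ne_zero (pow_ne_zero 2 hd) (by rw [← hc]; norm_num)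
  obtain ⟨s, hs, hst⟩ := exists_scalar_transport (n := 8) hc0
  have h1 := eval₂_orbitPullback (structureConstants μ) p φ (s * h).val
  rw [hq, MvPolynomial.eval₂_zero, ← hν, adjugateConstants_eq, transport_mul, hst, smul_smul] at h1
  have h2 : (s * h).val.det ^ 2 * c⁻¹ = 1 := by
    rw [Units.val_mul, Matrix.det_mul, hs]
    have h3 : c ^ 15 * h.val.det ^ 2 = 1 := by rw [hc]; field_simp
    have h4 : c * c⁻¹ = 1 := mul_inv_cancel₀ hc0
    linear_combination c ^ 15 * h.val.det ^ 2 * h4 + h3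
  rw [h2, one_smul] at h1
  exact h1.symm

theorem IsContraction.eval_eq_zero {μ ν : Bracket ℂ n} (h : IsContraction μ ν)
    {p : MvPolynomial (Fin n × Fin n × Fin n) ℂ}
    (hp : ∀ κ ∈ orbit ν, p.eval (structureConstants κ) = 0) :
    p.eval (structureConstants μ) = 0 := by
  obtain ⟨f, -, hf⟩ := h
  have h1 : Tendsto (fun ε => structureConstants (transport (f ε) ν)) (𝓝[>] 0)
      (𝓝 (structureConstants μ)) :=
    tendsto_pi_nhds.2 fun t => tendsto_pi_nhds.1 (hf (Pi.single t.1 1) (Pi.single t.2.1 1)) t.2.2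
  have h2 := ((MvPolynomial.continuous_eval p).tendsto _).comp h1
  refine tendsto_nhds_unique h2 ?_
  simp only [Function.comp_def, hp _ ⟨_, rfl⟩]
  exact tendsto_const_nhds

end Density

/-! ### Complexification and the closure of the orbit of `k8`. -/

section Complexification

open Module

variable {𝕜 : Type*} [Field 𝕜] {n : ℕ}

/-- The bracket over `L` with the structure constants of `μ`. -/
def extend {L : Type*} [Field L] (φ : 𝕜 →+* L) (μ : Bracket 𝕜 n) : Bracket L n :=
  ofConstants (φ ∘ structureConstants μ)

theorem extend_comp {L : Type*} [Field L] (φ : 𝕜 →+* L) (μ : Bracket 𝕜 n) (x y : Fin n → 𝕜) :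
    extend φ μ (φ ∘ x) (φ ∘ y) = φ ∘ μ x y := by
  rw [extend, ← map_ofConstants, ofConstants_structureConstants]

theorem comp_single {L : Type*} [Field L] (φ : 𝕜 →+* L) (i : Fin n) :
    φ ∘ (Pi.single i 1 : Fin n → 𝕜) = Pi.single i 1 := by
  ext j
  by_cases h : j = i
  · subst h; simp
  · simp [h]

/-- The identities are checked on basis vectors, which come from 𝕜. Alternation is not multilinear,
so it is obtained from skew-symmetry, in characteristic zero. -/
theorem extend_mem_twoNilp {L : Type*} [Field L] [CharZero L] (φ : 𝕜 →+* L) {μ : Bracket 𝕜 n}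
    (h : μ ∈ twoNilp 𝕜 n) : extend φ μ ∈ twoNilp L n := by
  rw [mem_twoNilp] at *
  have hφ0 : φ ∘ (0 : Fin n → 𝕜) = 0 := by ext; simp
  constructor
  · intro x
    have hs : (extend φ μ).flip = - extend φ μ := bracket_ext fun i j => by
      rw [LinearMap.flip_apply, LinearMap.neg_apply, LinearMap.neg_apply]
      simp only [← comp_single φ, extend_comp]
      rw [alt_neg h.1 (Pi.single i 1)]
      ext; simp
    exact self_eq_neg.1 (LinearMap.congr_fun₂ hs x x)
  · have h2 : ∀ x y : Fin n → 𝕜, (extend φ μ) (extend φ μ (φ ∘ x) (φ ∘ y)) = 0 := by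
      intro x y
      refine (Pi.basisFun L (Fin n)).ext fun i => ?_
      rw [Pi.basisFun_apply, ← comp_single φ, extend_comp, extend_comp, h.2, hφ0]
      rfl
    have h3 : (extend φ μ).compr₂ (extend φ μ) = 0 := by
      refine LinearMap.ext_basis (Pi.basisFun L (Fin n)) (Pi.basisFun L (Fin n)) fun i j => ?_
      rw [Pi.basisFun_apply, Pi.basisFun_apply, ← comp_single φ, ← comp_single φ,
        LinearMap.compr₂_apply, h2]
      rfl
    intro x y z
    exact LinearMap.congr_fun (LinearMap.congr_fun₂ h3 x y) z

theorem finrank_derived_extend_le {L : Type*} [Field L] (φ : 𝕜 →+* L) (μ : Bracket 𝕜 n) :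
    finrank L (derived (extend φ μ)) ≤ finrank 𝕜 (derived μ) := by
  let b := finBasis 𝕜 (derived μ)
  let W : Submodule L (Fin n → L) := Submodule.span L (Set.range fun i => φ ∘ (b i : Fin n → 𝕜))
  have hW : ∀ v ∈ derived μ, φ ∘ v ∈ W := by
    intro v hv
    have hv' : v = ∑ i, b.repr ⟨v, hv⟩ i • (b i : Fin n → 𝕜) := by
      have := congrArg (derived μ).subtype (b.sum_repr ⟨v, hv⟩)
      rw [map_sum] at this
      exact this.symm
    have : φ ∘ v = ∑ i, φ (b.repr ⟨v, hv⟩ i) • (φ ∘ (b i : Fin n → 𝕜)) := by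
      conv_lhs => rw [hv']
      ext k
      simp
    rw [this]
    exact Submodule.sum_mem _ fun i _ => Submodule.smul_mem _ _
      (Submodule.subset_span ⟨i, rfl⟩)
  have hle : derived (extend φ μ) ≤ W := derived_le fun x y => by
    have : (extend φ μ).compr₂ W.mkQ = 0 :=
      LinearMap.ext_basis (Pi.basisFun L (Fin n)) (Pi.basisFun L (Fin n)) fun i j => by
        rw [Pi.basisFun_apply, Pi.basisFun_apply, ← comp_single φ, ← comp_single φ,
          LinearMap.compr₂_apply, extend_comp]
        simpa using hW _ (mem_derived μ _ _)
    simpa using LinearMap.congr_fun₂ this x y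
  refine (Submodule.finrank_mono hle).trans ((finrank_range_le_card _).trans ?_)
  simp

theorem structureConstants_k8 {L : Type*} [Field L] (φ : 𝕜 →+* L) :
    structureConstants (k8 L) = φ ∘ structureConstants (k8 𝕜) := by
  have hs : ∀ i j : Fin 8, φ ((Pi.single i 1 : Fin 8 → 𝕜) j) = (Pi.single i 1 : Fin 8 → L) j :=
    fun i j => congrFun (comp_single φ i) j
  ext ⟨i, j, k⟩
  simp [structureConstants, k8, hs]

theorem exists_ringHom_complex (𝕜 : Type*) [RCLike 𝕜] : Nonempty (𝕜 →+* ℂ) := by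
  rcases RCLike.I_eq_zero_or_im_I_eq_one (K := 𝕜) with h | h
  · exact ⟨Complex.ofRealHom.comp (RCLike.realRingEquiv h).toRingHom⟩
  · exact ⟨(RCLike.complexRingEquiv h).toRingHom⟩

theorem finrank_derived_k8_le (𝕜 : Type*) [Field 𝕜] : finrank 𝕜 (derived (k8 𝕜)) ≤ 2 := by
  have hle : derived (k8 𝕜) ≤ Submodule.span 𝕜
      (Set.range ![(Pi.single 2 1 : Fin 8 → 𝕜), Pi.single 4 1]) := derived_le fun x y => by
    simp only [k8, LinearMap.sub_apply, LinearMap.neg_apply, along_apply]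
    exact Submodule.sub_mem _
      (Submodule.neg_mem _ (Submodule.smul_mem _ _ (Submodule.subset_span ⟨0, rfl⟩)))
      (Submodule.smul_mem _ _ (Submodule.subset_span ⟨1, rfl⟩))
  exact (Submodule.finrank_mono hle).trans ((finrank_range_le_card _).trans (by simp))

/-- The Zariski closure of the orbit of `k₈` consists of the two-step nilpotent brackets with
derived algebra of dimension at most two. -/
theorem mem_zariskiClosure_orbit_k8 {𝕜 : Type*} [RCLike 𝕜] {μ : Bracket 𝕜 8} :
    μ ∈ zariskiClosure (orbit (k8 𝕜)) ↔
      μ ∈ twoNilp 𝕜 8 ∧ finrank 𝕜 (derived μ) ≤ 2 := by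
  constructor
  · intro h
    refine ⟨h.1, finrank_derived_le_of_mem_zariskiClosure ?_ h⟩
    rintro _ ⟨g, rfl⟩
    exact (finrank_derived_transport_le g _).trans (finrank_derived_k8_le 𝕜)
  · rintro ⟨h, hd⟩
    refine mem_zariskiClosure_iff.2 ⟨h, fun p hp => ?_⟩
    obtain ⟨φ⟩ := exists_ringHom_complex 𝕜
    have hc := isContraction_k8 (extend_mem_twoNilp φ h) ((finrank_derived_extend_le φ μ).trans hd)
    have h0 := hc.eval_eq_zero (p := MvPolynomial.map φ p) fun κ hκ => by
      rw [MvPolynomial.eval_map]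
      exact eval₂_orbit_eq_zero φ (structureConstants_k8 φ) hp hκ
    rw [MvPolynomial.eval_map, extend, structureConstants_ofConstants] at h0
    have h1 := MvPolynomial.eval₂_comp φ (structureConstants μ) p
    exact φ.injective (by rw [map_zero, ← h0]; exact h1)

end Complexification

/-! ### An intrinsic description of C₁. -/

section Component

open Module

variable {𝕜 : Type*} [Field 𝕜]

theorem exists_linearIndependent_finCons {V : Type*} [AddCommGroup V] [Module 𝕜 V]
    [FiniteDimensional 𝕜 V] {m : ℕ} {v : Fin m → V} (hv : LinearIndependent 𝕜 v)
    {N : Submodule 𝕜 V} (hvN : ∀ i, v i ∈ N) (hm : m < finrank 𝕜 N) :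
    ∃ k ∈ N, LinearIndependent 𝕜 (Matrix.vecCons k v) := by
  have hle : Submodule.span 𝕜 (Set.range v) ≤ N :=
    Submodule.span_le.2 (by rintro _ ⟨i, rfl⟩; exact hvN i)
  obtain ⟨k, hk, hk'⟩ := SetLike.exists_of_lt (lt_of_le_of_ne hle (fun h => by
    have := finrank_range_le_card (R := 𝕜) v
    rw [Set.finrank, h, Fintype.card_fin] at this
    omega))
  exact ⟨k, hk, hv.finCons hk'⟩

/-- A bracket with an operator `ad x` of rank two that fills the derived algebra has an adapted
basis. -/
theorem exists_adapted_basis {μ : Bracket 𝕜 8} (h : μ ∈ twoNilp 𝕜 8)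
    (hd : finrank 𝕜 (derived μ) ≤ 2) {x u v : Fin 8 → 𝕜}
    (hli : LinearIndependent 𝕜 ![μ x u, μ x v]) :
    ∃ b : Fin 8 → Fin 8 → 𝕜, LinearIndependent 𝕜 b ∧ b 0 = x ∧ μ x (b 1) = b 2 ∧
      μ x (b 3) = b 4 ∧ (∀ j, j ≠ 1 → j ≠ 3 → μ x (b j) = 0) ∧
      ∀ z ∈ derived μ, ∃ s t : 𝕜, z = s • b 2 + t • b 4 := by
  have hpair := LinearIndependent.pair_iff.1 hli
  have hu0 : μ x u ≠ 0 := fun h0 => by simpa using hpair 1 0 (by simp [h0])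
  have hv0 : μ x v ≠ 0 := fun h0 => by simpa using hpair 0 1 (by simp [h0])
  -- The kernel contains x and the two products; dimension 6 leaves room for three more vectors, and
  -- u, v complete the basis.
  have hker : 6 ≤ finrank 𝕜 (LinearMap.ker (μ x)) := by
    have h1 := (μ x).finrank_range_add_finrank_ker
    have h2 : finrank 𝕜 (LinearMap.range (μ x)) ≤ 2 :=
      (Submodule.finrank_mono (by rintro _ ⟨y, rfl⟩; exact mem_derived μ x y)).trans hd
    rw [finrank_fin_fun] at h1
    omega
  have hz₁ : μ x u ∈ LinearMap.ker (μ x) := derived_central' h (mem_derived μ _ _) _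
  have hz₂ : μ x v ∈ LinearMap.ker (μ x) := derived_central' h (mem_derived μ _ _) _
  have hx : x ∈ LinearMap.ker (μ x) := h.1.1 x
  have h3 : LinearIndependent 𝕜 ![x, μ x u, μ x v] := by
    refine hli.finCons fun hmem => hu0 ?_
    have hle : Submodule.span 𝕜 (Set.range ![μ x u, μ x v]) ≤ derived μ :=
      Submodule.span_le.2 (by
        rintro _ ⟨i, rfl⟩
        fin_cases i
        · exact mem_derived μ x u
        · exact mem_derived μ x v)
    exact derived_central h (hle hmem) u
  obtain ⟨k₁, hk₁, h4⟩ := exists_linearIndependent_finCons h3 (N := LinearMap.ker (μ x))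
    (by simp only [Fin.forall_fin_succ, Matrix.cons_val]; simp [hx, hz₁, hz₂]) (by omega)
  obtain ⟨k₂, hk₂, h5⟩ := exists_linearIndependent_finCons h4 (N := LinearMap.ker (μ x))
    (by simp only [Fin.forall_fin_succ, Matrix.cons_val]; simp [hx, hz₁, hz₂, hk₁]) (by omega)
  obtain ⟨k₃, hk₃, h6⟩ := exists_linearIndependent_finCons h5 (N := LinearMap.ker (μ x))
    (by simp only [Fin.forall_fin_succ, Matrix.cons_val]; simp [hx, hz₁, hz₂, hk₁, hk₂]) (by omega)
  rw [LinearMap.mem_ker] at hz₁ hz₂ hx hk₁ hk₂ hk₃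
  have h7 : LinearIndependent 𝕜 ![v, k₃, k₂, k₁, x, μ x u, μ x v] := by
    refine h6.finCons fun hmem => hv0 ?_
    have hle : Submodule.span 𝕜 (Set.range ![k₃, k₂, k₁, x, μ x u, μ x v]) ≤
        LinearMap.ker (μ x) := Submodule.span_le.2 (by
      rintro _ ⟨i, rfl⟩
      fin_cases i <;> simp [hx, hz₁, hz₂, hk₁, hk₂, hk₃])
    exact hle hmem
  have h8 : LinearIndependent 𝕜 ![u, v, k₃, k₂, k₁, x, μ x u, μ x v] := by
    refine h7.finCons fun hmem => ?_
    have hle : Submodule.span 𝕜 (Set.range ![v, k₃, k₂, k₁, x, μ x u, μ x v]) ≤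
        (𝕜 ∙ μ x v).comap (μ x) := Submodule.span_le.2 (by
      rintro _ ⟨i, rfl⟩
      fin_cases i <;> simp [hx, hz₁, hz₂, hk₁, hk₂, hk₃, Submodule.mem_span_singleton_self])
    obtain ⟨a, ha⟩ := Submodule.mem_span_singleton.1 (hle hmem)
    simpa using hpair 1 (-a) (by simp [ha])
  refine ⟨![x, u, μ x u, v, μ x v, k₁, k₂, k₃], ?_, rfl, rfl, rfl, ?_, ?_⟩
  · convert h8.comp ![5, 0, 6, 1, 7, 4, 3, 2] (by decide) using 1
    ext i
    fin_cases i <;> rfl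
  · intro j hj1 hj3
    fin_cases j <;> first
      | exact absurd rfl hj1
      | exact absurd rfl hj3
      | simp [hx, hz₁, hz₂, hk₁, hk₂, hk₃]
  · intro z hz
    have hspan : Submodule.span 𝕜 {μ x u, μ x v} = derived μ := by
      refine Submodule.eq_of_le_of_finrank_le (Submodule.span_le.2 ?_) ?_
      · rintro _ (rfl | rfl)
        · exact mem_derived μ x u
        · exact mem_derived μ x v
      · have := finrank_span_eq_card hli
        rw [Fintype.card_fin] at this
        rwa [show ({μ x u, μ x v} : Set (Fin 8 → 𝕜)) = Set.range ![μ x u, μ x v] by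
          simp [Matrix.range_cons, Set.pair_comm], this]
    rw [← hspan] at hz
    obtain ⟨s, t, hst⟩ := Submodule.mem_span_pair.1 hz
    exact ⟨s, t, hst.symm⟩

theorem g24_single_zero (y : Fin 8 → 𝕜) :
    g24 𝕜 (Pi.single 0 1) y = y 1 • Pi.single 2 1 + y 3 • Pi.single 4 1 := by
  simp [g24]

/-- In an adapted basis ad X₁ coincides with that of `g24`, and all products lie in the span of X₃
and X₅; the difference with `g24` is then an admissible cocycle. -/
theorem mem_C1_iff {μ : Bracket 𝕜 8} : μ ∈ C1 𝕜 ↔ μ ∈ twoNilp 𝕜 8 ∧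
    finrank 𝕜 (derived μ) ≤ 2 ∧ ∃ x u v, LinearIndependent 𝕜 ![μ x u, μ x v] := by
  constructor
  · rintro ⟨φ, ⟨hφ, hφ0, hφs⟩, g, rfl⟩
    have hspan : ∀ x y, (g24 𝕜 + φ) x y ∈
        Submodule.span 𝕜 {(Pi.single 2 1 : Fin 8 → 𝕜), Pi.single 4 1} := fun x y => by
      refine Submodule.add_mem _ ?_ (hφs x y)
      exact Submodule.add_mem _
        (Submodule.smul_mem _ _ (Submodule.subset_span (Set.mem_insert _ _)))
        (Submodule.smul_mem _ _ (Submodule.subset_span (Set.mem_insert_of_mem _ rfl)))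
    have hν : g24 𝕜 + φ ∈ twoNilp 𝕜 8 := by
      rw [mem_twoNilp]
      refine ⟨fun x => by simp [g24, hφ, mul_comm], fun x y z => ?_⟩
      obtain ⟨s, t, hst⟩ := Submodule.mem_span_pair.1 (hspan x y)
      rw [← hst]
      simp [g24, (hφ0 z).2.1, (hφ0 z).2.2]
    have hd : finrank 𝕜 (derived (g24 𝕜 + φ)) ≤ 2 := by
      refine (Submodule.finrank_mono (derived_le hspan)).trans ?_
      have := finrank_range_le_card (R := 𝕜) ![(Pi.single 2 1 : Fin 8 → 𝕜), Pi.single 4 1]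
      rwa [Set.finrank, Matrix.range_cons, Matrix.range_cons, Matrix.range_empty, Set.union_empty,
        Set.singleton_union, Fintype.card_fin] at this
    refine ⟨transport_mem_twoNilp g hν, (finrank_derived_transport_le g _).trans hd,
      g.val.mulVec (Pi.single 0 1), g.val.mulVec (Pi.single 1 1), g.val.mulVec (Pi.single 3 1), ?_⟩
    rw [transport_mulVec, transport_mulVec, LinearMap.add_apply, LinearMap.add_apply,
      LinearMap.add_apply, g24_single_zero, g24_single_zero, (hφ0 _).1, (hφ0 _).1,
      LinearIndependent.pair_iff]
    intro s t hst
    have h1 : (g⁻¹).val.mulVec (s • g.val.mulVec (Pi.single 2 1 : Fin 8 → 𝕜) +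
        t • g.val.mulVec (Pi.single 4 1)) = 0 := by
      rw [← Matrix.mulVec_zero (g⁻¹).val, ← hst]
      simp
    rw [Matrix.mulVec_add, Matrix.mulVec_smul, Matrix.mulVec_smul, GL_inv_mulVec,
      GL_inv_mulVec] at h1
    exact ⟨by simpa using congrFun h1 2, by simpa using congrFun h1 4⟩
  · rintro ⟨h, hd, x, u, v, hli⟩
    obtain ⟨b, hb, h0, h12, h34, hzero, hder⟩ := exists_adapted_basis h hd hli
    obtain ⟨g, hg⟩ := exists_GL_of_linearIndependent hb
    have hg' : ∀ i, (g⁻¹).val.mulVec (b i) = Pi.single i 1 := fun i => by rw [← hg, GL_inv_mulVec]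
    have hν : ∀ x y, transport g⁻¹ μ x y =
        (g⁻¹).val.mulVec (μ (g.val.mulVec x) (g.val.mulVec y)) := fun x y => by
      rw [transport_apply, inv_inv]
    have hb2 : ∀ y, μ (b 2) y = 0 := derived_central h (h12 ▸ mem_derived μ _ _)
    have hb4 : ∀ y, μ (b 4) y = 0 := derived_central h (h34 ▸ mem_derived μ _ _)
    refine ⟨transport g⁻¹ μ - g24 𝕜, ⟨fun x => ?_, fun y => ⟨?_, ?_, ?_⟩, fun x y => ?_⟩, g, ?_⟩
    · rw [LinearMap.sub_apply, LinearMap.sub_apply, hν, h.1.1]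
      simp [g24, mul_comm]
    · have : (transport g⁻¹ μ - g24 𝕜) (Pi.single 0 1) = 0 := by
        refine (Pi.basisFun 𝕜 (Fin 8)).ext fun j => ?_
        rw [Pi.basisFun_apply, LinearMap.sub_apply, LinearMap.sub_apply, g24_single_zero, hν,
          hg, hg, h0]
        by_cases h1 : j = 1
        · subst h1; rw [h12, hg']; simp
        by_cases h3 : j = 3
        · subst h3; rw [h34, hg']; simp
        rw [hzero j h1 h3]
        simp [Ne.symm h1, Ne.symm h3]
      rw [this]; rfl
    · rw [LinearMap.sub_apply, LinearMap.sub_apply, hν, hg, hb2]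
      simp [g24]
    · rw [LinearMap.sub_apply, LinearMap.sub_apply, hν, hg, hb4]
      simp [g24]
    · obtain ⟨s, t, hst⟩ := hder _ (mem_derived μ (g.val.mulVec x) (g.val.mulVec y))
      rw [LinearMap.sub_apply, LinearMap.sub_apply, hν, hst, Matrix.mulVec_add,
        Matrix.mulVec_smul, Matrix.mulVec_smul, hg', hg']
      have h2 : (Pi.single 2 1 : Fin 8 → 𝕜) ∈
          Submodule.span 𝕜 {(Pi.single 2 1 : Fin 8 → 𝕜), Pi.single 4 1} :=
        Submodule.subset_span (Set.mem_insert _ _)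
      have h4 : (Pi.single 4 1 : Fin 8 → 𝕜) ∈
          Submodule.span 𝕜 {(Pi.single 2 1 : Fin 8 → 𝕜), Pi.single 4 1} :=
        Submodule.subset_span (Set.mem_insert_of_mem _ rfl)
      exact Submodule.sub_mem _
        (Submodule.add_mem _ (Submodule.smul_mem _ _ h2) (Submodule.smul_mem _ _ h4))
        (Submodule.add_mem _ (Submodule.smul_mem _ _ h2) (Submodule.smul_mem _ _ h4))
    · have : g24 𝕜 + (transport g⁻¹ μ - g24 𝕜) = transport g⁻¹ μ :=
        LinearMap.ext₂ fun x y => by simp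
      rw [this, ← transport_mul, mul_inv_cancel, transport_one]

theorem orbit_k8_subset_C1 : orbit (k8 𝕜) ⊆ C1 𝕜 := by
  have hk : k8 𝕜 ∈ C1 𝕜 := by
    refine mem_C1_iff.2 ⟨k8_mem_twoNilp 𝕜, finrank_derived_k8_le 𝕜, Pi.single 0 1, Pi.single 1 1,
      Pi.single 3 1, ?_⟩
    rw [LinearIndependent.pair_iff]
    intro s t hst
    exact ⟨by simpa [k8] using congrFun hst 2, by simpa [k8] using congrFun hst 4⟩
  rintro ν hν
  obtain ⟨φ, hφ, ho⟩ := hk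
  exact ⟨φ, hφ, mem_orbit_trans hν ho⟩

end Component

/-! ### Jordan types and the characteristic sequence. -/

section CharacteristicSequence

open Module

theorem list_le_of_jordan_bounds {l : List ℕ} (hsort : l.Pairwise (· ≥ ·))
    (hpos : ∀ k ∈ l, 0 < k) (hle : ∀ k ∈ l, k ≤ 2)
    (hsum : l.sum = 8) (h2 : ∀ h : 2 < l.length, l[2] ≤ 1) : l ≤ [2, 2, 1, 1, 1, 1] := by
  rw [← not_lt]
  rcases l with _ | ⟨a, _ | ⟨b, _ | ⟨c, _ | ⟨d, _ | ⟨e, _ | ⟨f, _ | ⟨g, l⟩⟩⟩⟩⟩⟩⟩ <;>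
    simp [List.cons_lt_cons_iff] at hsort hpos hle hsum h2 ⊢ <;> omega

variable {𝕜 : Type*} [Field 𝕜]

/-- Since T² = 0 no block exceeds 2. Each block of size 2 puts a basis vector in the range of T, so
there are at most two of them. -/
theorem IsNilpotentJordanType.le {T : (Fin 8 → 𝕜) →ₗ[𝕜] (Fin 8 → 𝕜)} (hT : ∀ x, T (T x) = 0)
    (hr : finrank 𝕜 (LinearMap.range T) ≤ 2) {l : List ℕ} (h : IsNilpotentJordanType T l) :
    l ≤ [2, 2, 1, 1, 1, 1] := by
  obtain ⟨hsort, hpos, b, hb⟩ := h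
  refine list_le_of_jordan_bounds hsort hpos (fun k hk => ?_) ?_ fun h2 => ?_
  · by_contra! hk2
    obtain ⟨i, rfl⟩ := List.get_of_mem hk
    have h1 := (hb i ⟨0, by omega⟩).2 ⟨1, by omega⟩ rfl
    have h2 := (hb i ⟨1, by omega⟩).2 ⟨2, by omega⟩ rfl
    have h3 := hT (b ⟨i, ⟨2, by omega⟩⟩)
    rw [h2, h1] at h3
    exact b.ne_zero _ h3
  · have h1 := finrank_eq_card_basis b
    rw [finrank_fin_fun, Fintype.card_sigma] at h1
    simp only [Fintype.card_fin] at h1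
    rw [h1, ← List.sum_ofFn, List.ofFn_get]
  · by_contra! h3
    have hge : ∀ i : Fin 3, 1 < l.get ⟨i, by omega⟩ := by
      intro i
      have hi : i.val ≤ 2 := by omega
      rcases hi.lt_or_eq with hlt | heq
      · exact lt_of_lt_of_le h3 (List.pairwise_iff_getElem.1 hsort i 2 (by omega) h2 hlt)
      · simpa [heq] using h3
    let w : Fin 3 → LinearMap.range T := fun i => ⟨b ⟨⟨i, by omega⟩, ⟨0, (hge i).trans' one_pos⟩⟩,
      ⟨_, (hb _ ⟨0, (hge i).trans' one_pos⟩).2 ⟨1, hge i⟩ rfl⟩⟩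
    have hw : LinearIndependent 𝕜 w := by
      refine LinearIndependent.of_comp (LinearMap.range T).subtype ?_
      refine b.linearIndependent.comp
        (fun i : Fin 3 => (⟨⟨i, by omega⟩, ⟨0, (hge i).trans' one_pos⟩⟩ :
          Σ i : Fin l.length, Fin (l.get i))) fun i j hij => ?_
      have := congrArg (fun s => s.1.val) hij
      exact Fin.ext this
    have := hw.fintype_card_le_finrank
    rw [Fintype.card_fin] at this
    omega

/-- The position of the Jordan basis vector with index `(i, j)` in an adapted basis. -/
def jordanIndex (s : Σ i : Fin [2, 2, 1, 1, 1, 1].length, Fin ([2, 2, 1, 1, 1, 1].get i)) :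
    Fin 8 :=
  if s.1.val = 0 then (if s.2.val = 0 then 2 else 1)
  else if s.1.val = 1 then (if s.2.val = 0 then 4 else 3)
  else if s.1.val = 2 then 0
  else if s.1.val = 3 then 5
  else if s.1.val = 4 then 6
  else 7

theorem jordanIndex_injective : Function.Injective jordanIndex := by
  decide

theorem jordanIndex_zero : ∀ i j, j.val = 0 → jordanIndex ⟨i, j⟩ ≠ 1 ∧ jordanIndex ⟨i, j⟩ ≠ 3 := by
  decide

theorem jordanIndex_succ : ∀ i, ∀ j j' : Fin ([2, 2, 1, 1, 1, 1].get i), j'.val = j.val + 1 →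
    (jordanIndex ⟨i, j'⟩ = 1 ∧ jordanIndex ⟨i, j⟩ = 2) ∨
      (jordanIndex ⟨i, j'⟩ = 3 ∧ jordanIndex ⟨i, j⟩ = 4) := by
  decide

/-- When the derived algebra has dimension at most 2, every ad X has square zero and rank at most 2,
so (2,2,1,1,1,1) is the largest conceivable type. It is attained exactly when some ad x has two
independent values. -/
theorem mem_C1_iff_F24 {μ : Bracket 𝕜 8} :
    μ ∈ C1 𝕜 ↔ μ ∈ F24 𝕜 ∧ finrank 𝕜 (derived μ) ≤ 2 := by
  rw [mem_C1_iff]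
  constructor
  · rintro ⟨h, hd, x, u, v, hli⟩
    refine ⟨⟨h, ⟨x, fun hx => ?_, ?_⟩, fun X _ l hl => hl.le (fun y => ?_) ?_⟩, hd⟩
    · have h0 := LinearIndependent.ne_zero 0 hli
      exact h0 (derived_central h hx u)
    · obtain ⟨b, hb, h0, h12, h34, hzero, -⟩ := exists_adapted_basis h hd hli
      refine ⟨by decide, by decide, ?_⟩
      have hli' := hb.comp jordanIndex jordanIndex_injective
      have : Nonempty (Σ i : Fin [2, 2, 1, 1, 1, 1].length, Fin ([2, 2, 1, 1, 1, 1].get i)) :=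
        ⟨⟨0, ⟨0, by decide⟩⟩⟩
      let B := basisOfLinearIndependentOfCardEqFinrank hli' (by
        rw [finrank_fin_fun]; rfl)
      have hB : ∀ s, B s = b (jordanIndex s) := fun s => by
        simp [B]
      refine ⟨B, fun i j => ?_⟩
      rw [hB]
      refine ⟨fun hj => ?_, fun j' hj' => ?_⟩
      · obtain ⟨h1, h3⟩ := jordanIndex_zero i j hj
        exact hzero _ h1 h3
      · rw [hB]
        rcases jordanIndex_succ i j j' hj' with ⟨h1, h2⟩ | ⟨h1, h2⟩
        · rw [h1, h2, h12]
        · rw [h1, h2, h34]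
    · exact derived_central' h (mem_derived μ _ _) _
    · exact (Submodule.finrank_mono (by rintro _ ⟨y, rfl⟩; exact mem_derived μ X y)).trans hd
  · rintro ⟨⟨h, ⟨x, -, -, -, b, hb⟩, -⟩, hd⟩
    have h1 := (hb 0 ⟨0, by decide⟩).2 ⟨1, by decide⟩ rfl
    have h2 := (hb 1 ⟨0, by decide⟩).2 ⟨1, by decide⟩ rfl
    refine ⟨h, hd, x, b ⟨0, ⟨1, by decide⟩⟩, b ⟨1, ⟨1, by decide⟩⟩, ?_⟩
    rw [h1, h2]
    have h3 := b.linearIndependent.comp ![⟨0, ⟨0, by decide⟩⟩, ⟨1, ⟨0, by decide⟩⟩] (by decide)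
    have h4 : b ∘ ![⟨0, ⟨0, by decide⟩⟩, ⟨1, ⟨0, by decide⟩⟩] =
        ![b ⟨0, ⟨0, by decide⟩⟩, b ⟨1, ⟨0, by decide⟩⟩] := by
      funext i
      fin_cases i <;> rfl
    rw [h4] at h3
    exact h3

end CharacteristicSequence

end TwoNilp

end

theorem mainTheorem8 :
    (∀ (𝕜 : Type) [RCLike 𝕜],
      TwoNilp.C1 𝕜 = TwoNilp.F24 𝕜 ∩ TwoNilp.zariskiClosure (TwoNilp.orbit (TwoNilp.k8 𝕜)) ∧
      TwoNilp.zariskiClosure (TwoNilp.C1 𝕜) =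
        TwoNilp.zariskiClosure (TwoNilp.orbit (TwoNilp.k8 𝕜))) ∧
    (∀ μ ∈ TwoNilp.zariskiClosure (TwoNilp.C1 ℂ), μ ∉ TwoNilp.orbit (TwoNilp.k8 ℂ) →
      TwoNilp.IsContraction μ (TwoNilp.k8 ℂ)) := by
  have hC1 : ∀ (𝕜 : Type) [RCLike 𝕜],
      TwoNilp.C1 𝕜 ⊆ TwoNilp.zariskiClosure (TwoNilp.orbit (TwoNilp.k8 𝕜)) := fun 𝕜 _ μ hμ =>
    have h := TwoNilp.mem_C1_iff.1 hμ
    TwoNilp.mem_zariskiClosure_orbit_k8.2 ⟨h.1, h.2.1⟩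
  refine ⟨fun 𝕜 _ => ⟨?_, ?_⟩, fun μ hμ _ => ?_⟩
  · ext μ
    rw [TwoNilp.mem_C1_iff_F24, Set.mem_inter_iff, TwoNilp.mem_zariskiClosure_orbit_k8]
    exact ⟨fun h => ⟨h.1, h.1.1, h.2⟩, fun h => ⟨h.1, h.2.2⟩⟩
  -- C₁ lies between the orbit of `k8` and its closure.
  · exact (TwoNilp.zariskiClosure_subset_of_subset (hC1 𝕜)).antisymm
      (TwoNilp.zariskiClosure_mono TwoNilp.orbit_k8_subset_C1)
  · have h := TwoNilp.mem_zariskiClosure_orbit_k8.1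
      (TwoNilp.zariskiClosure_subset_of_subset (hC1 ℂ) hμ)
    exact TwoNilp.isContraction_k8 h.1 h.2
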